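/- Let $k$ be a field that is complete for an ultrametric absolute value $|\cdot|$ (possibly trivial). **The line.** $\mathbf{A}^1_k$ denotes the Berkovich affine line, the set of multiplicative seminorms $P\mapsto |P(x)|$ on $k[T]$ extending $|\cdot|$, with the topology of pointwise convergence and the order $x\le y \iff |P(x)|\le |P(y)|$ for all $P$; $\mathbf{P}^1_k=\mathbf{A}^1_k\cup\{\infty\}$ is its one-point compactification. A point is of type 2 or 3 if it is the image of some $\eta_{\beta,r}$ with $\beta\in\overline{k}$, $r>0$, where $|P(\eta_{\beta,r})|=\max_i|a_i|r^i$ for $P=\sum_i a_i(T-\beta)^i$. For $x\in\mathbf{A}^1_k$ put $$\operatorname{diam}(x)=\inf\{|P(x)|^{1/\deg P} : P\in k[T] \text{ monic, nonconstant}\}$$ (this is $\inf_{a\in k}|(T-a)(x)|$ if $k$ is algebraically closed, and $\operatorname{diam}(\eta_{\alpha,r})=r$ for $\alpha\in k$). Let $x\vee y$ be the least common upper bound of $x,y$, and $\sup\{x,y\}=\operatorname{diam}(x\vee y)$. **Segments.** For $x,y$ of type 2 or 3, $[x,y]=[x,x\vee y]\cup[x\vee y,y]$, and its logarithmic length is $$\ell([x,y])=\log\frac{\operatorname{diam}(x\vee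 y)}{\operatorname{diam}(x)}+\log\frac{\operatorname{diam}(x\vee y)}{\operatorname{diam}(y)};$$ in particular $\ell([\eta_{\alpha,r},\eta_{\alpha,s}])=\log(s/r)$ for $\alpha\in k$, $0<r\le s$. Let $\mathrm{Seg}_k$ be the set of such segments (single points allowed). For $I\in\mathrm{Seg}_k$, let $\mu_I$ be the Dirac measure if $I$ is a single point, and otherwise the Lebesgue measure of $I$ (for the length $\ell$) normalized to total mass $1$, viewed as a measure on $\mathbf{P}^1_k$. **Energy.** For signed measures $\rho,\rho'$ on $\mathbf{P}^1_k$ such that $\log\sup\{x,y\}$ is $|\rho|\otimes|\rho'|$-integrable on $\mathbf{A}^1_k\times\mathbf{A}^1_k$ deprived of the diagonal of the points of diameter $0$, put $(\rho,\rho')=-\int\log\sup\{x,y\}\,d\rho(x)\otimes d\rho'(y)$ (integral over that set). Put $E(I,J)=\tfrac12(\mu_I-\mu_J,\mu_I-\mu_J)$. **Theorem.** Let $I_a=[p_a,q_a]$ and $I_b=[p_b,q_b]$ be in $\mathrm{Seg}_k$ with $\sharp(I_a\cap I_b)\le 1$. Then $E(I_a,I_b)$ is well defined. Let $\ell_a,\ell_b$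 be the lengths of $I_a,I_b$ and $d_{ab}=\inf\{\ell([u,v]) : u\in I_a, v\in I_b\}$ their distance. There is a unique pair $(z_a,z_b)\in I_a\times I_b$ with $\ell([z_a,z_b])=d_{ab}$. With $\ell'_a=\ell([p_a,z_a])$, $\ell''_a=\ell([z_a,q_a])$, $\ell'_b=\ell([p_b,z_b])$, $\ell''_b=\ell([z_b,q_b])$, one has $$E(I_a,I_b)=\frac16\ell_a+\frac16\ell_b+\frac12 d_{ab}-\frac12\frac{\ell'_a\ell''_a}{\ell_a}-\frac12\frac{\ell'_b\ell''_b}{\ell_b},$$ where a quotient is read as $0$ if its denominator is $0$. In particular, $$E(I_a,I_b)\ge\frac1{24}\ell_a+\frac1{24}\ell_b+\frac12 d_{ab}.$$ -/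

import Mathlib

open MeasureTheory Polynomial

noncomputable section

namespace Berkovich

/-- The Berkovich affine line over `k`: the multiplicative seminorms on `k[T]` that extend the
absolute value of `k`. -/
structure A1 (k : Type*) [NormedField k] where
  toSeminorm : MulRingSeminorm k[X]
  map_C : ∀ a : k, toSeminorm (C a) = ‖a‖

variable {k : Type*} [NormedField k]

/-- The value `|P(x)|` of a polynomial at a point of the line. -/
def A1.val (x : A1 k) (P : k[X]) : ℝ := x.toSeminorm P

/-- The topology of pointwise convergence. -/
instance : TopologicalSpace (A1 k) := TopologicalSpace.induced A1.val inferInstance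

/-- The usual partial order: `x ≤ y` if `|P(x)| ≤ |P(y)|` for all polynomials `P`. -/
instance : LE (A1 k) := ⟨fun x y => ∀ P : k[X], x.val P ≤ y.val P⟩

/-- The Berkovich projective line, the one-point compactification of the affine line. -/
abbrev P1 (k : Type*) [NormedField k] : Type _ := OnePoint (A1 k)

instance : MeasurableSpace (P1 k) := borel (P1 k)

instance : BorelSpace (P1 k) := ⟨rfl⟩

/-- Points of type 2 or 3: the images in the line over `k` of the points `η_{β,r}` of the line over
(the completion of) an algebraic closure of `k`, with `r > 0`. Here
`|P(η_{β,r})| = max_i |a_i| r ^ i`, where `P = ∑ a_i (T - β) ^ i`, and the spectral norm is the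
unique absolute value on the algebraic closure that extends the one of `k`. By density, centres
in the algebraic closure suffice. -/
def A1.IsType23 (x : A1 k) : Prop :=
  ∃ (β : AlgebraicClosure k) (r : ℝ), 0 < r ∧ ∀ P : k[X],
    x.val P = ⨆ i : ℕ, spectralNorm k (AlgebraicClosure k)
      ((taylor β (P.map (algebraMap k (AlgebraicClosure k)))).coeff i) * r ^ i

/-- The diameter of a point: the infimum of `|P(x)| ^ (1 / deg P)` over the monic nonconstant
polynomials `P`. When `k` is algebraically closed, each such `P` is a product of factors `T - a`,
and this is the usual diameter `inf_a |T - a|(x)`. In general it is the geometric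
mean of `max (|β - β'|, r)` over the conjugates `β'` of `β` if `x` is the image of `η_{β,r}`; for
`β` in `k` it is `r`. -/
def A1.diam (x : A1 k) : ℝ :=
  ⨅ P : {P : k[X] // P.Monic ∧ 0 < P.natDegree}, x.val P.1 ^ (1 / (P.1.natDegree : ℝ))

/-- The ultrametric analogue of `|z - w|`: the diameter of the smallest point above `x`
and `y`. -/
def A1.sup (x y : A1 k) : ℝ := ⨅ w : {w : A1 k // x ≤ w ∧ y ≤ w}, w.1.diam

/-- The segment `[x, y]`: the points above `x` or above `y` that lie below every common upper bound
of `x` and `y`, that is, the path from `x` up to the join of `x` and `y` and down to `y`. -/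
def A1.segment (x y : A1 k) : Set (A1 k) :=
  {z | (x ≤ z ∨ y ≤ z) ∧ ∀ w, x ≤ w → y ≤ w → z ≤ w}

/-- The logarithmic length of the segment `[x, y]`: for `j` the join of `x` and `y`, it is
`log (diam j / diam x) + log (diam j / diam y)`. -/
def A1.length (x y : A1 k) : ℝ :=
  2 * Real.log (x.sup y) - Real.log x.diam - Real.log y.diam

/-- A segment of the projective line whose end points are of type 2 or 3; it may be a
single point. -/
structure Seg (k : Type*) [NormedField k] where
  p : A1 k
  q : A1 k
  hp : p.IsType23
  hq : q.IsType23

/-- The set of points of a segment (the point at infinity is never among them). -/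
def Seg.carrier (I : Seg k) : Set (A1 k) := I.p.segment I.q

/-- The length of a segment. -/
def Seg.length (I : Seg k) : ℝ := I.p.length I.q

/-- The arc length parametrization of a segment: for `0 ≤ t ≤ ℓ(I)`, the point of the segment
at distance `t` from its first end point. -/
def Seg.param (I : Seg k) (t : ℝ) : P1 k :=
  haveI : Nonempty (A1 k) := ⟨I.p⟩
  ((Function.invFunOn (fun z => I.p.length z) I.carrier t : A1 k) : P1 k)

open Classical in
/-- The measure `μ_I` on the projective line: the Dirac measure if `I` is a single point, and
otherwise the image of the Lebesgue measure on `I` normalized to total mass `1`. -/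
def Seg.measure (I : Seg k) : Measure (P1 k) :=
  if I.p = I.q then Measure.dirac (I.p : P1 k)
  else Measure.map I.param
    (ENNReal.ofReal (I.length)⁻¹ • (volume : Measure ℝ).restrict (Set.Icc 0 I.length))

instance (I : Seg k) : IsFiniteMeasure I.measure := by
  unfold Seg.measure
  split_ifs
  · infer_instance
  · have : IsFiniteMeasure
        (ENNReal.ofReal (I.length)⁻¹ • (volume : Measure ℝ).restrict (Set.Icc 0 I.length)) :=
      Measure.smul_finite _ ENNReal.ofReal_ne_top
    infer_instance

open Classical in
/-- The kernel `log sup{x, y}`, extended by `0` where the energy integral is not taken: at infinity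
and on the diagonal of the points of diameter zero. -/
def logKernel (z : P1 k × P1 k) : ℝ :=
  match z with
  | (some x, some y) => if x = y ∧ x.diam = 0 then 0 else Real.log (x.sup y)
  | _ => 0

/-- The integrability condition under which the mutual energy is defined. -/
def EnergyDefined (ρ ρ' : SignedMeasure (P1 k)) : Prop :=
  Integrable logKernel (ρ.totalVariation.prod ρ'.totalVariation)

/-- The integral of the kernel for the product of two (positive) measures. -/
def kernelIntegral (μ ν : Measure (P1 k)) : ℝ := ∫ z, logKernel z ∂(μ.prod ν)

/-- The mutual energy `(ρ, ρ') = - ∫ log sup{x, y} dρ(x) ⊗ dρ'(y)` of two signed measures, computed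
through their positive and negative parts. -/
def energy (ρ ρ' : SignedMeasure (P1 k)) : ℝ :=
  kernelIntegral ρ.toJordanDecomposition.posPart ρ'.toJordanDecomposition.negPart
    + kernelIntegral ρ.toJordanDecomposition.negPart ρ'.toJordanDecomposition.posPart
    - kernelIntegral ρ.toJordanDecomposition.posPart ρ'.toJordanDecomposition.posPart
    - kernelIntegral ρ.toJordanDecomposition.negPart ρ'.toJordanDecomposition.negPart

/-- The signed measure `μ_I - μ_J`. -/
def Seg.diffMeasure (I J : Seg k) : SignedMeasure (P1 k) :=
  I.measure.toSignedMeasure - J.measure.toSignedMeasure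

/-- `E(I, J) = (1/2) (μ_I - μ_J, μ_I - μ_J)`. -/
def Seg.E (I J : Seg k) : ℝ := 1 / 2 * energy (I.diffMeasure J) (I.diffMeasure J)

/-- The distance between two segments. -/
def Seg.dist (I J : Seg k) : ℝ := ⨅ z : I.carrier × J.carrier, z.1.1.length z.2.1

/-- `z` and `w` are points of `I` and `J` that realize the distance between the segments. -/
def Seg.IsNearest (I J : Seg k) (z w : A1 k) : Prop :=
  z ∈ I.carrier ∧ w ∈ J.carrier ∧ z.length w = I.dist J

end Berkovich

end

noncomputable section

namespace Berkovich

variable {k : Type*} [NormedField k]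

/-! ### Multiplicative seminorms: the ultrametric inequality, and chains above a point. -/

section Order

/-! The line is a tree, and `log sup{x, y}` is half of `ℓ(x, y) + log diam x + log diam y`. Since
`μ_I` and `μ_J` both have mass 1, the diameter terms cancel in the energy of `μ_I - μ_J`, and only
mean path lengths remain: `E(I, J)` is half the mean of `ℓ` over `I × J`, minus a quarter of its
means over `I × I` and `J × J`. On one segment `ℓ` is `|s - t|` in arc length, with mean `ℓ_I / 3`.
For two segments meeting in at most one point, every path from `I` to `J` runs through a bridge `[z,
w]`, so `ℓ` is `|s - a| + ℓ(z, w) + |t - b|`, where `a`, `b` are the coordinates of `z`, `w`; the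
mean of `|s - a|` is `ℓ_I / 2 - a (ℓ_I - a) / ℓ_I`. The bridge also identifies the unique nearest
pair.

The tree structure rests on three facts. The points above a given point form a chain on which the
diameter is strictly increasing (`A1.le_total_of_le`, `A1.diam_lt_diam`), by division by a monic
polynomial of minimal degree separating two points. Joins exist (`A1.exists_isLUB`), as infima of
chains of common upper bounds. The points above `η_{β,r}` form a continuous ray
(`A1.IsType23.exists_ray`). The bridge is `A1.exists_isBridge`; `energy_toSignedMeasure_sub` removes
the Jordan decomposition from the energy. -/

theorem A1.ext_val {x y : A1 k} (h : ∀ f, x.val f = y.val f) : x = y := by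
  obtain ⟨s, hs⟩ := x
  obtain ⟨t, ht⟩ := y
  have : s = t := DFunLike.ext _ _ h
  subst this
  rfl

instance : PartialOrder (A1 k) where
  le x y := x ≤ y
  le_refl _ _ := le_rfl
  le_trans _ _ _ h h' f := (h f).trans (h' f)
  le_antisymm _ _ h h' := A1.ext_val fun f => le_antisymm (h f) (h' f)

namespace A1

variable (x : A1 k)

theorem val_C (a : k) : x.val (C a) = ‖a‖ := x.map_C a

@[simp] theorem val_zero : x.val 0 = 0 := map_zero x.toSeminorm

@[simp] theorem val_one : x.val 1 = 1 := map_one x.toSeminorm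

@[simp] theorem val_mul (f g : k[X]) : x.val (f * g) = x.val f * x.val g :=
  map_mul x.toSeminorm f g

@[simp] theorem val_pow (f : k[X]) (n : ℕ) : x.val (f ^ n) = x.val f ^ n :=
  map_pow x.toSeminorm f n

@[simp] theorem val_neg (f : k[X]) : x.val (-f) = x.val f := map_neg_eq_map x.toSeminorm f

theorem val_nonneg (f : k[X]) : 0 ≤ x.val f := apply_nonneg x.toSeminorm f

theorem val_add_le_add (f g : k[X]) : x.val (f + g) ≤ x.val f + x.val g :=
  map_add_le_add x.toSeminorm f g

theorem val_sum_le {ι : Type*} (s : Finset ι) (f : ι → k[X]) :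
    x.val (∑ i ∈ s, f i) ≤ ∑ i ∈ s, x.val (f i) :=
  Finset.le_sum_of_subadditive x.val x.val_zero.le x.val_add_le_add s f

variable [IsUltrametricDist k]

theorem val_natCast_le_one (n : ℕ) : x.val (n : k[X]) ≤ 1 := by
  rw [← C_eq_natCast, val_C]
  exact IsUltrametricDist.norm_natCast_le_one k n

/-- Every point of the line is an ultrametric seminorm. -/
theorem val_add_le (f g : k[X]) : x.val (f + g) ≤ max (x.val f) (x.val g) := by
  set M := max (x.val f) (x.val g) with hM
  have hM0 : 0 ≤ M := (x.val_nonneg f).trans (le_max_left _ _)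
  -- Binomial coefficients have value at most 1; the factor `n + 1` is subexponential, so it
  -- disappears for large `n`.
  have key (n : ℕ) : x.val (f + g) ^ n ≤ (n + 1) * M ^ n := by
    rw [← val_pow, add_pow]
    refine (x.val_sum_le _ _).trans ?_
    calc ∑ m ∈ Finset.range (n + 1), x.val (f ^ m * g ^ (n - m) * (n.choose m : k[X]))
        ≤ ∑ _m ∈ Finset.range (n + 1), M ^ n := by
          refine Finset.sum_le_sum fun m hm => ?_
          have hmn : m + (n - m) = n := by have := Finset.mem_range.1 hm; omega
          rw [val_mul, val_mul, val_pow, val_pow]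
          calc x.val f ^ m * x.val g ^ (n - m) * x.val (n.choose m : k[X])
              ≤ x.val f ^ m * x.val g ^ (n - m) * 1 := by
                gcongr
                · exact mul_nonneg (pow_nonneg (x.val_nonneg _) _) (pow_nonneg (x.val_nonneg _) _)
                · exact x.val_natCast_le_one _
            _ ≤ M ^ m * M ^ (n - m) := by
                rw [mul_one]
                gcongr
                · exact pow_nonneg (x.val_nonneg _) _
                · exact x.val_nonneg _
                · exact le_max_left _ _
                · exact x.val_nonneg _
                · exact le_max_right _ _
            _ = M ^ n := by rw [← pow_add, hmn]
      _ = (n + 1) * M ^ n := by simp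
  refine le_of_forall_gt_imp_ge_of_dense fun a ha => ?_
  rcases hM0.eq_or_lt with h0 | h0
  · have := key 1
    rw [← h0] at this
    simp only [pow_one, mul_zero] at this
    exact this.trans (h0.trans_lt ha).le
  obtain ⟨n, hn⟩ := Real.exists_natCast_add_one_lt_pow_of_one_lt ((one_lt_div h0).2 ha)
  rw [div_pow, lt_div_iff₀ (pow_pos h0 n)] at hn
  refine le_of_pow_le_pow_left₀ (n := n) ?_ (h0.trans ha).le ((key n).trans hn.le)
  rintro rfl
  simp at hn

theorem val_sub_le (f g : k[X]) : x.val (f - g) ≤ max (x.val f) (x.val g) := by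
  rw [sub_eq_add_neg, ← x.val_neg g]
  exact x.val_add_le f (-g)

end A1

/-- If `x < z`, there is a monic polynomial `P` of minimal degree at which `x` and `z` differ. -/
theorem A1.exists_monic_minimal {x z : A1 k} (hxz : x ≤ z) (hne : x ≠ z) :
    ∃ P : k[X], P.Monic ∧ 0 < P.natDegree ∧ x.val P < z.val P ∧
      ∀ g : k[X], g.natDegree < P.natDegree → z.val g = x.val g := by
  classical
  have hex : ∃ n, ∃ f : k[X], f.natDegree = n ∧ x.val f < z.val f := by
    by_contra! h
    exact hne (A1.ext_val fun f => le_antisymm (hxz f) (h _ f rfl))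
  obtain ⟨f, hfn, hf⟩ := Nat.find_spec hex
  have hmin (g : k[X]) (hg : g.natDegree < f.natDegree) : z.val g = x.val g := by
    rw [hfn] at hg
    have := Nat.find_min hex hg
    push Not at this
    exact le_antisymm (this g rfl) (hxz g)
  have hf0 : f ≠ 0 := by
    rintro rfl
    simp at hf
  have hlc : f.leadingCoeff ≠ 0 := leadingCoeff_ne_zero.2 hf0
  have hdeg : (f * C f.leadingCoeff⁻¹).natDegree = f.natDegree :=
    natDegree_mul_C (inv_ne_zero hlc)
  refine ⟨f * C f.leadingCoeff⁻¹, monic_mul_leadingCoeff_inv hf0, ?_, ?_, ?_⟩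
  · rw [hdeg]
    by_contra h
    rw [eq_C_of_natDegree_eq_zero (Nat.eq_zero_of_not_pos h), A1.val_C, A1.val_C] at hf
    exact hf.false
  · rw [A1.val_mul, A1.val_mul, A1.val_C, A1.val_C]
    exact mul_lt_mul_of_pos_right hf (norm_pos_iff.2 (inv_ne_zero hlc))
  · rwa [hdeg]

variable [IsUltrametricDist k]

/-- A polynomial `P` of minimal degree at which `x < z` differ is a key polynomial of `z`. -/
theorem A1.val_add_mul_eq_max {x z : A1 k} (hxz : x ≤ z) {P : k[X]} (hP : x.val P < z.val P)
    {g : k[X]} (hg : z.val g = x.val g) (h : k[X]) :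
    z.val (g + P * h) = max (z.val g) (z.val P * z.val h) := by
  rw [← A1.val_mul]
  refine le_antisymm (z.val_add_le _ _) ?_
  by_contra! hlt
  have h1 : z.val g ≤ max (z.val (g + P * h)) (z.val (P * h)) := by
    simpa using z.val_sub_le (g + P * h) (P * h)
  have h2 : z.val (P * h) ≤ max (z.val (g + P * h)) (z.val g) := by
    simpa using z.val_sub_le (g + P * h) g
  -- A value below the maximum forces the two terms to have equal value at `z`. At `x` the second
  -- term is strictly smaller while `g` keeps its value, so `g` dominates there and `x ≤ z` is
  -- violated.
  have hEq : z.val g = z.val (P * h) := by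
    rcases le_max_iff.1 h1 with h1 | h1 <;> rcases le_max_iff.1 h2 with h2 | h2
    · exact absurd (max_le h1 h2) hlt.not_ge
    · exact absurd (max_le h1 (h2.trans h1)) hlt.not_ge
    · exact absurd (max_le (h1.trans h2) h2) hlt.not_ge
    · exact le_antisymm h1 h2
  rw [← hEq, max_self] at hlt
  have h3 : x.val g ≤ max (x.val (g + P * h)) (x.val (P * h)) := by
    simpa using x.val_sub_le (g + P * h) (P * h)
  have hh : 0 < z.val h := by
    refine (z.val_nonneg h).lt_of_ne fun h0 => ?_
    rw [A1.val_mul, ← h0, mul_zero] at hEq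
    exact hlt.not_ge (hEq.le.trans (z.val_nonneg _))
  have h4 : x.val (P * h) < z.val g := by
    rw [hEq, A1.val_mul, A1.val_mul]
    exact (mul_le_mul_of_nonneg_left (hxz h) (x.val_nonneg P)).trans_lt
      (mul_lt_mul_of_pos_right hP hh)
  rw [← hg] at h3
  exact absurd h3 (max_lt ((hxz _).trans_lt hlt) h4).not_ge

/-- Divide by `P` and induct on the degree: in `f = g + P h`, the point `z` attains the maximum of
the two terms, whereas `w` is only bounded by the corresponding maximum. -/
theorem A1.le_of_val_le {x z w : A1 k} (hxz : x ≤ z) {P : k[X]} (hPm : P.Monic)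
    (hP0 : 0 < P.natDegree) (hP : x.val P < z.val P)
    (hz : ∀ g : k[X], g.natDegree < P.natDegree → z.val g = x.val g)
    (hw : ∀ g : k[X], g.natDegree < P.natDegree → w.val g = x.val g)
    (hwz : w.val P ≤ z.val P) : w ≤ z := by
  suffices h : ∀ n, ∀ f : k[X], f.natDegree = n → w.val f ≤ z.val f from fun f => h _ f rfl
  intro n
  induction n using Nat.strong_induction_on with
  | _ n ih =>
    intro f hf
    rcases lt_or_ge f.natDegree P.natDegree with hlt | hge
    · rw [hz f hlt, hw f hlt]
    have hg : (f %ₘ P).natDegree < P.natDegree :=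
      natDegree_modByMonic_lt f hPm (fun h => by simp [h] at hP0)
    have hh : (f /ₘ P).natDegree < n := by
      rw [natDegree_divByMonic f hPm]
      omega
    rw [← modByMonic_add_div f P, A1.val_add_mul_eq_max hxz hP (hz _ hg)]
    refine (w.val_add_le _ _).trans (max_le_max ?_ ?_)
    · rw [hz _ hg, hw _ hg]
    · rw [A1.val_mul]
      exact mul_le_mul hwz (ih _ hh _ rfl) (w.val_nonneg _) (z.val_nonneg _)

/-- The points above a given point form a chain. -/
theorem A1.le_total_of_le {x z w : A1 k} (hz : x ≤ z) (hw : x ≤ w) : z ≤ w ∨ w ≤ z := by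
  by_cases hxz : x = z
  · exact Or.inl (hxz ▸ hw)
  by_cases hxw : x = w
  · exact Or.inr (hxw ▸ hz)
  obtain ⟨P, hPm, hP0, hP, hPz⟩ := A1.exists_monic_minimal hz hxz
  obtain ⟨Q, hQm, hQ0, hQ, hQw⟩ := A1.exists_monic_minimal hw hxw
  -- The point that separates from `x` in smaller degree is the larger one; in equal degrees the
  -- values at `P` decide.
  rcases lt_trichotomy P.natDegree Q.natDegree with h | h | h
  · refine Or.inr (A1.le_of_val_le hz hPm hP0 hP hPz (fun g hg => hQw g (hg.trans h)) ?_)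
    rw [hQw P h]
    exact hP.le
  · have hPw (g : k[X]) (hg : g.natDegree < P.natDegree) : w.val g = x.val g := hQw g (h ▸ hg)
    rcases le_total (w.val P) (z.val P) with h' | h'
    · exact Or.inr (A1.le_of_val_le hz hPm hP0 hP hPz hPw h')
    · exact Or.inl (A1.le_of_val_le hw hPm hP0 (hP.trans_le h') hPw hPz h')
  · refine Or.inl (A1.le_of_val_le hw hQm hQ0 hQ hQw (fun g hg => hPz g (hg.trans h)) ?_)
    rw [hPz Q h]
    exact hQ.le

end Order

/-! ### Strict monotonicity of the diameter. -/

section Diam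

open Filter Topology

theorem A1.bddBelow_diam (x : A1 k) :
    BddBelow (Set.range fun P : {P : k[X] // P.Monic ∧ 0 < P.natDegree} =>
      x.val P.1 ^ (1 / (P.1.natDegree : ℝ))) :=
  ⟨0, by rintro _ ⟨P, rfl⟩; exact Real.rpow_nonneg (x.val_nonneg _) _⟩

theorem A1.diam_le (x : A1 k) {P : k[X]} (hP : P.Monic) (hP0 : 0 < P.natDegree) :
    x.diam ≤ x.val P ^ (1 / (P.natDegree : ℝ)) :=
  ciInf_le x.bddBelow_diam ⟨P, hP, hP0⟩

instance nonempty_monic : Nonempty {P : k[X] // P.Monic ∧ 0 < P.natDegree} :=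
  ⟨⟨X, monic_X, by simp⟩⟩

theorem A1.le_diam {x : A1 k} {c : ℝ}
    (h : ∀ P : k[X], P.Monic → 0 < P.natDegree → c ^ P.natDegree ≤ x.val P) (hc : 0 ≤ c) :
    c ≤ x.diam := by
  refine le_ciInf fun P => ?_
  have hn : (P.1.natDegree : ℝ) ≠ 0 := Nat.cast_ne_zero.2 P.2.2.ne'
  calc c = (c ^ P.1.natDegree) ^ (1 / (P.1.natDegree : ℝ)) := by
        rw [← Real.rpow_natCast, ← Real.rpow_mul hc, mul_one_div_cancel hn, Real.rpow_one]
    _ ≤ _ := Real.rpow_le_rpow (pow_nonneg hc _) (h _ P.2.1 P.2.2) (by positivity)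

theorem A1.diam_nonneg (x : A1 k) : 0 ≤ x.diam :=
  le_ciInf fun _ => Real.rpow_nonneg (x.val_nonneg _) _

theorem A1.diam_pow_le (x : A1 k) {P : k[X]} (hP : P.Monic) (hP0 : 0 < P.natDegree) :
    x.diam ^ P.natDegree ≤ x.val P := by
  have hn : (P.natDegree : ℝ) ≠ 0 := Nat.cast_ne_zero.2 hP0.ne'
  calc x.diam ^ P.natDegree ≤ (x.val P ^ (1 / (P.natDegree : ℝ))) ^ P.natDegree :=
        pow_le_pow_left₀ x.diam_nonneg (x.diam_le hP hP0) _
    _ = x.val P := by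
        rw [← Real.rpow_natCast, ← Real.rpow_mul (x.val_nonneg _), one_div_mul_cancel hn,
          Real.rpow_one]

theorem A1.diam_mono {x z : A1 k} (h : x ≤ z) : x.diam ≤ z.diam :=
  A1.le_diam (fun _ hP hP0 => (x.diam_pow_le hP hP0).trans (h _)) x.diam_nonneg

theorem A1.log_diam_mono {x y : A1 k} (hx : 0 < x.diam) (h : x ≤ y) :
    Real.log x.diam ≤ Real.log y.diam :=
  Real.log_le_log hx (A1.diam_mono h)

variable [IsUltrametricDist k]

/-- Each division of `F` by `P` leaves a monic quotient and contributes one factor `z.val P`. Hence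
`P` realizes the infimum defining the diameter of `z`. -/
theorem A1.pow_val_le_val {x z : A1 k} (hxz : x ≤ z) {P : k[X]} (hPm : P.Monic)
    (hP0 : 0 < P.natDegree) (hP : x.val P < z.val P)
    (hz : ∀ g : k[X], g.natDegree < P.natDegree → z.val g = x.val g) (m : ℕ) {F : k[X]}
    (hF : F.Monic) (hFd : F.natDegree = P.natDegree * m) : z.val P ^ m ≤ z.val F := by
  induction m generalizing F with
  | zero =>
    rw [hF.natDegree_eq_zero.1 (by simpa using hFd)]
    simp
  | succ m ih =>
    have hg : (F %ₘ P).natDegree < P.natDegree :=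
      natDegree_modByMonic_lt F hPm (fun h => by simp [h] at hP0)
    have hle : P.degree ≤ F.degree := by
      rw [degree_eq_natDegree hPm.ne_zero, degree_eq_natDegree hF.ne_zero, hFd]
      exact_mod_cast Nat.le_mul_of_pos_right _ m.succ_pos
    have hq : (F /ₘ P).Monic := by
      rw [Monic, leadingCoeff_divByMonic_of_monic hPm hle]
      exact hF
    have hd : (F /ₘ P).natDegree = P.natDegree * m := by
      rw [natDegree_divByMonic F hPm, hFd, Nat.mul_succ]
      omega
    rw [← modByMonic_add_div F P, A1.val_add_mul_eq_max hxz hP (hz _ hg), pow_succ']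
    exact (mul_le_mul_of_nonneg_left (ih hq hd) (z.val_nonneg _)).trans (le_max_right _ _)

/-- The diameter is strictly increasing. -/
theorem A1.diam_lt_diam {x z : A1 k} (hxz : x ≤ z) (hne : x ≠ z) : x.diam < z.diam := by
  obtain ⟨P, hPm, hP0, hP, hPz⟩ := A1.exists_monic_minimal hxz hne
  have hn : (0 : ℝ) < 1 / (P.natDegree : ℝ) := by positivity
  refine (x.diam_le hPm hP0).trans_lt
    ((Real.rpow_lt_rpow (x.val_nonneg _) hP hn).trans_le (A1.le_diam (fun F hF hF0 => ?_)
      (Real.rpow_nonneg (z.val_nonneg _) _)))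
  -- Passing to `F ^ deg P` makes the degree a multiple of `deg P`.
  have h := A1.pow_val_le_val hxz hPm hP0 hP hPz F.natDegree (hF.pow P.natDegree)
    (hF.natDegree_pow _)
  rw [A1.val_pow] at h
  refine le_of_pow_le_pow_left₀ hP0.ne' (z.val_nonneg _) (le_trans (le_of_eq ?_) h)
  rw [← pow_mul, mul_comm, pow_mul, ← Real.rpow_natCast (_ ^ (1 / (P.natDegree : ℝ))),
    ← Real.rpow_mul (z.val_nonneg _), one_div_mul_cancel (Nat.cast_ne_zero.2 hP0.ne'),
    Real.rpow_one]

theorem A1.eq_of_le_of_diam_le {x z : A1 k} (hxz : x ≤ z) (h : z.diam ≤ x.diam) : x = z := by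
  by_contra hne
  exact (A1.diam_lt_diam hxz hne).not_ge h

/-- On the points above a given point, the order is detected by the diameter. -/
theorem A1.le_of_diam_le {x z w : A1 k} (hz : x ≤ z) (hw : x ≤ w) (h : z.diam ≤ w.diam) :
    z ≤ w := by
  rcases A1.le_total_of_le hz hw with h' | h'
  · exact h'
  · exact (A1.eq_of_le_of_diam_le h' h).ge

theorem A1.eq_of_diam_eq {x z w : A1 k} (hz : x ≤ z) (hw : x ≤ w) (h : z.diam = w.diam) :
    z = w :=
  le_antisymm (A1.le_of_diam_le hz hw h.le) (A1.le_of_diam_le hw hz h.ge)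

theorem A1.eq_of_log_diam_eq {x y z : A1 k} (hx : 0 < x.diam) (hy : x ≤ y) (hz : x ≤ z)
    (h : Real.log y.diam = Real.log z.diam) : y = z :=
  A1.eq_of_diam_eq hy hz (Real.log_injOn_pos (hx.trans_le (A1.diam_mono hy))
    (hx.trans_le (A1.diam_mono hz)) h)

end Diam

/-! ### Joins as limits of decreasing families of seminorms. -/

section Join

open Filter Topology

/-- The infimum of a nonempty downward directed family of points. -/
def infPoint {ι : Type*} [Nonempty ι] [Preorder ι] [IsCodirectedOrder ι] (w : ι → A1 k)
    (hw : Monotone w) : A1 k :=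
  have lim (f : k[X]) : Tendsto (fun i => (w i).val f) atBot (𝓝 (⨅ i, (w i).val f)) :=
    tendsto_atBot_ciInf (fun _ _ h => hw h f)
      ⟨0, by rintro _ ⟨i, rfl⟩; exact (w i).val_nonneg f⟩
  { toSeminorm :=
      { toFun := fun f => ⨅ i, (w i).val f
        map_zero' := by simp
        add_le' := fun f g => le_of_tendsto_of_tendsto' (lim (f + g)) ((lim f).add (lim g))
          fun i => (w i).val_add_le_add f g
        neg' := fun f => by simp
        map_one' := by simp
        map_mul' := fun f g => tendsto_nhds_unique (lim (f * g)) (by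
          simpa only [A1.val_mul] using (lim f).mul (lim g)) }
    map_C := fun a => by
      change ⨅ i, (w i).val (C a) = _
      simp [A1.val_C] }

theorem infPoint_le {ι : Type*} [Nonempty ι] [Preorder ι] [IsCodirectedOrder ι] (w : ι → A1 k)
    (hw : Monotone w) (i : ι) : infPoint w hw ≤ w i := fun f =>
  ciInf_le ⟨0, by rintro _ ⟨i, rfl⟩; exact (w i).val_nonneg f⟩ i

theorem le_infPoint {ι : Type*} [Nonempty ι] [Preorder ι] [IsCodirectedOrder ι] (w : ι → A1 k)
    (hw : Monotone w) {x : A1 k} (h : ∀ i, x ≤ w i) : x ≤ infPoint w hw := fun f =>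
  le_ciInf fun i => h i f

/-- All common upper bounds lie above `x`, so they form a chain, whose pointwise infimum is again a
multiplicative seminorm. -/
theorem A1.exists_isLUB_pair [IsUltrametricDist k] {x y w : A1 k} (hx : x ≤ w) (hy : y ≤ w) :
    ∃ j, IsLUB {x, y} j := by
  let ι := {w : A1 k // x ≤ w ∧ y ≤ w}
  have : Nonempty ι := ⟨⟨w, hx, hy⟩⟩
  have : IsCodirectedOrder ι := ⟨fun a b => by
    rcases A1.le_total_of_le a.2.1 b.2.1 with h | h
    · exact ⟨a, le_rfl, h⟩
    · exact ⟨b, h, le_rfl⟩⟩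
  refine ⟨infPoint (fun i : ι => i.1) (fun _ _ h => h), ?_, ?_⟩
  · rintro z (rfl | rfl)
    · exact le_infPoint _ _ fun i => i.2.1
    · exact le_infPoint _ _ fun i => i.2.2
  · intro z hz
    exact infPoint_le (fun i : ι => i.1) (fun _ _ h => h)
      ⟨z, hz (by simp), hz (by simp)⟩

theorem A1.sup_eq_of_isLUB {x y j : A1 k} (h : IsLUB {x, y} j) : x.sup y = j.diam := by
  have hx : x ≤ j := h.1 (by simp)
  have hy : y ≤ j := h.1 (by simp)
  have : Nonempty {w : A1 k // x ≤ w ∧ y ≤ w} := ⟨⟨j, hx, hy⟩⟩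
  refine le_antisymm (ciInf_le ⟨0, ?_⟩ (⟨j, hx, hy⟩ : {w : A1 k // x ≤ w ∧ y ≤ w})) ?_
  · rintro _ ⟨w, rfl⟩
    exact w.1.diam_nonneg
  · refine le_ciInf fun w => A1.diam_mono (h.2 ?_)
    rintro z (rfl | rfl)
    exacts [w.2.1, w.2.2]

end Join

/-! ### The points `η_{β,r}` and the rays above them. -/

section Disc

/-- The Taylor expansion at `β` of a polynomial over `k`. -/
abbrev expansion (β : AlgebraicClosure k) (f : k[X]) : (AlgebraicClosure k)[X] :=
  taylor β (f.map (algebraMap k (AlgebraicClosure k)))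

theorem natDegree_expansion (β : AlgebraicClosure k) (f : k[X]) :
    (expansion β f).natDegree = f.natDegree := by
  rw [expansion, natDegree_taylor, natDegree_map]

theorem coeff_natDegree_expansion (β : AlgebraicClosure k) {P : k[X]} (hP : P.Monic) :
    (expansion β P).coeff P.natDegree = 1 := by
  have : (expansion β P).leadingCoeff = 1 := by
    rw [expansion, leadingCoeff_taylor]
    exact hP.map _
  rwa [leadingCoeff, natDegree_expansion] at this

theorem A1.continuous_iff {Y : Type*} [TopologicalSpace Y] {γ : Y → A1 k} :
    Continuous γ ↔ ∀ f, Continuous fun y => (γ y).val f := by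
  rw [continuous_induced_rng, continuous_pi_iff]
  rfl

variable [IsUltrametricDist k] [CompleteSpace k]

theorem spectralNorm_algebraicClosure_mul (x y : AlgebraicClosure k) :
    spectralNorm k (AlgebraicClosure k) (x * y) =
      spectralNorm k (AlgebraicClosure k) x * spectralNorm k (AlgebraicClosure k) y := by
  by_cases h : ∃ a : k, 1 < ‖a‖
  · let : NontriviallyNormedField k := { (inferInstance : NormedField k) with non_trivial := h }
    exact spectralAlgNorm_mul x y
  -- In the trivially valued case all integral elements have norm at most 1, and comparing `z` with
  -- its inverse forces norm 1 for `z ≠ 0`.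
  push Not at h
  have hle (z : AlgebraicClosure k) : spectralNorm k (AlgebraicClosure k) z ≤ 1 :=
    (spectralValue_le_one_iff (minpoly.monic (Algebra.IsIntegral.isIntegral z))).2 fun _ => h _
  have hone (z : AlgebraicClosure k) (hz : z ≠ 0) : spectralNorm k (AlgebraicClosure k) z = 1 := by
    refine le_antisymm (hle z) ?_
    have := spectralNorm_mul (K := k) (Algebra.IsAlgebraic.isAlgebraic z)
      (Algebra.IsAlgebraic.isAlgebraic z⁻¹)
    rw [mul_inv_cancel₀ hz, spectralNorm_one] at this
    exact this.trans (mul_le_of_le_one_right (spectralNorm_nonneg z) (hle _))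
  rcases eq_or_ne x 0 with rfl | hx
  · simp [spectralNorm_zero]
  rcases eq_or_ne y 0 with rfl | hy
  · simp [spectralNorm_zero]
  rw [hone x hx, hone y hy, hone _ (mul_ne_zero hx hy), one_mul]

variable (k) in
/-- The absolute value of the algebraic closure of `k`. -/
def spectralAbv : AbsoluteValue (AlgebraicClosure k) ℝ where
  toFun := spectralNorm k (AlgebraicClosure k)
  map_mul' := spectralNorm_algebraicClosure_mul
  nonneg' := spectralNorm_nonneg
  eq_zero' x := ⟨fun h => eq_zero_of_map_spectralNorm_eq_zero h
    (Algebra.IsAlgebraic.isAlgebraic x), fun h => h ▸ spectralNorm_zero⟩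
  add_le' x y := (isNonarchimedean_spectralNorm x y).trans
    (max_le_add_of_nonneg (spectralNorm_nonneg x) (spectralNorm_nonneg y))

theorem isNonarchimedean_spectralAbv : IsNonarchimedean (spectralAbv k) :=
  isNonarchimedean_spectralNorm

theorem spectralAbv_algebraMap (a : k) :
    spectralAbv k (algebraMap k (AlgebraicClosure k) a) = ‖a‖ :=
  spectralNorm_extends a

theorem iSup_eq_gaussNorm (f : (AlgebraicClosure k)[X]) {r : ℝ} (hr : 0 < r) :
    ⨆ i : ℕ, spectralNorm k (AlgebraicClosure k) (f.coeff i) * r ^ i =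
      f.gaussNorm (spectralAbv k) r := by
  refine le_antisymm (ciSup_le fun i => le_gaussNorm (spectralAbv k) f hr.le i) ?_
  obtain ⟨i, hi⟩ := exists_eq_gaussNorm (spectralAbv k) r f
  rw [hi]
  refine le_ciSup (f := fun i => spectralNorm k (AlgebraicClosure k) (f.coeff i) * r ^ i)
    ⟨f.gaussNorm (spectralAbv k) r, ?_⟩ i
  rintro _ ⟨j, rfl⟩
  exact le_gaussNorm (spectralAbv k) f hr.le j

/-- The point `η_{β,r}`. -/
def discPoint (β : AlgebraicClosure k) {r : ℝ} (hr : 0 < r) : A1 k where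
  toSeminorm :=
    { toFun := fun f => (expansion β f).gaussNorm (spectralAbv k) r
      map_zero' := by simp [expansion]
      add_le' := fun f g => by
        simp only [expansion, Polynomial.map_add, map_add]
        exact (isNonarchimedean_gaussNorm _ isNonarchimedean_spectralAbv hr.le _ _).trans
          (max_le_add_of_nonneg (gaussNorm_nonneg _ _ hr.le) (gaussNorm_nonneg _ _ hr.le))
      neg' := fun f => by
        simp only [expansion, Polynomial.map_neg, map_neg, ← iSup_eq_gaussNorm _ hr, coeff_neg]
        simp only [spectralNorm_neg (Algebra.IsAlgebraic.isAlgebraic (R := k) _)]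
      map_one' := by
        have : expansion β (1 : k[X]) = C 1 := by simp [expansion]
        rw [this, gaussNorm_C]
        exact spectralNorm_one
      map_mul' := fun f g => by
        simp only [expansion, Polynomial.map_mul, taylor_mul]
        exact gaussNorm_mul isNonarchimedean_spectralAbv hr _ _ }
  map_C a := by
    change (expansion β (C a)).gaussNorm (spectralAbv k) r = _
    rw [expansion, Polynomial.map_C, taylor_C, gaussNorm_C, spectralAbv_algebraMap]

theorem discPoint_val (β : AlgebraicClosure k) {r : ℝ} (hr : 0 < r) (f : k[X]) :
    (discPoint β hr).val f = (expansion β f).gaussNorm (spectralAbv k) r := rfl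

theorem discPoint_mono (β : AlgebraicClosure k) {r s : ℝ} (hr : 0 < r) (hs : 0 < s) (h : r ≤ s) :
    discPoint β hr ≤ discPoint β hs := fun f => by
  rw [discPoint_val, discPoint_val]
  obtain ⟨i, hi⟩ := exists_eq_gaussNorm (spectralAbv k) r (expansion β f)
  rw [hi]
  refine le_trans ?_ (le_gaussNorm _ _ hs.le i)
  gcongr

theorem discPoint_val_le (β : AlgebraicClosure k) {r s : ℝ} (hr : 0 < r) (hs : 0 < s) (h : r ≤ s)
    (f : k[X]) :
    (discPoint β hs).val f ≤ (s / r) ^ f.natDegree * (discPoint β hr).val f := by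
  rw [discPoint_val, discPoint_val]
  obtain ⟨i, hi⟩ := exists_eq_gaussNorm (spectralAbv k) s (expansion β f)
  rw [hi]
  rcases lt_or_ge f.natDegree i with hlt | hge
  · rw [← natDegree_expansion β] at hlt
    rw [coeff_eq_zero_of_natDegree_lt hlt, map_zero, zero_mul]
    exact mul_nonneg (by positivity) (gaussNorm_nonneg _ _ hr.le)
  · calc spectralAbv k ((expansion β f).coeff i) * s ^ i
        = (s / r) ^ i * (spectralAbv k ((expansion β f).coeff i) * r ^ i) := by
          rw [div_pow]
          field_simp
      _ ≤ (s / r) ^ f.natDegree * (expansion β f).gaussNorm (spectralAbv k) r := by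
          gcongr
          · exact (one_le_div hr).2 h
          · exact le_gaussNorm _ _ hr.le i

/-- The minimal polynomial of `β` has no constant term at `β`, so the dominant term of its expansion
grows strictly with the radius. -/
theorem discPoint_ne (β : AlgebraicClosure k) {r s : ℝ} (hr : 0 < r) (hs : 0 < s) (h : r < s) :
    discPoint β hr ≠ discPoint β hs := by
  intro heq
  set P := minpoly k β with hPdef
  have hP : P.Monic := minpoly.monic (Algebra.IsIntegral.isIntegral β)
  have hval : (discPoint β hr).val P = (discPoint β hs).val P := by rw [heq]
  obtain ⟨i, hi⟩ := exists_eq_gaussNorm (spectralAbv k) r (expansion β P)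
  have hpos : 0 < spectralAbv k ((expansion β P).coeff i) * r ^ i := by
    have h1 := le_gaussNorm (spectralAbv k) (expansion β P) hr.le P.natDegree
    rw [coeff_natDegree_expansion β hP, map_one, one_mul, hi] at h1
    exact (pow_pos hr _).trans_le h1
  have hi0 : i ≠ 0 := by
    rintro rfl
    rw [taylor_coeff_zero, eval_map_algebraMap, hPdef, minpoly.aeval, map_zero, zero_mul] at hpos
    exact hpos.false
  have hlt : spectralAbv k ((expansion β P).coeff i) * r ^ i <
      spectralAbv k ((expansion β P).coeff i) * s ^ i :=
    mul_lt_mul_of_pos_left (pow_lt_pow_left₀ h hr.le hi0)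
      (pos_of_mul_pos_left hpos (pow_pos hr i).le)
  rw [discPoint_val, discPoint_val, hi] at hval
  exact absurd (hlt.trans_le (le_gaussNorm _ _ hs.le i)) hval.not_lt

theorem le_diam_discPoint (β : AlgebraicClosure k) {r : ℝ} (hr : 0 < r) :
    r ≤ (discPoint β hr).diam := by
  refine A1.le_diam (fun P hP _ => ?_) hr.le
  have h := le_gaussNorm (spectralAbv k) (expansion β P) hr.le P.natDegree
  rwa [coeff_natDegree_expansion β hP, map_one, one_mul] at h

/-- The value of a polynomial of degree `n` grows by at most `(s / r) ^ n`. Together with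
monotonicity, this bound makes the diameter continuous along the ray. -/
theorem diam_discPoint_le (β : AlgebraicClosure k) {r s : ℝ} (hr : 0 < r) (hs : 0 < s)
    (h : r ≤ s) : (discPoint β hs).diam ≤ s / r * (discPoint β hr).diam := by
  have : r / s * (discPoint β hs).diam ≤ (discPoint β hr).diam := by
    refine A1.le_diam (fun P hP hP0 => ?_) (mul_nonneg (by positivity) (A1.diam_nonneg _))
    have h1 := (A1.diam_pow_le (discPoint β hs) hP hP0).trans (discPoint_val_le β hr hs h P)
    rw [mul_pow]
    calc (r / s) ^ P.natDegree * (discPoint β hs).diam ^ P.natDegree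
        ≤ (r / s) ^ P.natDegree * ((s / r) ^ P.natDegree * (discPoint β hr).val P) := by gcongr
      _ = (discPoint β hr).val P := by
          rw [← mul_assoc, ← mul_pow, div_mul_div_cancel₀ hs.ne', div_self hr.ne', one_pow, one_mul]
  calc (discPoint β hs).diam = s / r * (r / s * (discPoint β hs).diam) := by field_simp
    _ ≤ _ := by gcongr

theorem A1.IsType23.exists_eq {x : A1 k} (hx : x.IsType23) :
    ∃ (β : AlgebraicClosure k) (r : ℝ) (hr : 0 < r), x = discPoint β hr := by
  obtain ⟨β, r, hr, h⟩ := hx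
  exact ⟨β, r, hr, A1.ext_val fun f => by rw [h f, iSup_eq_gaussNorm _ hr, discPoint_val]⟩

theorem A1.IsType23.diam_pos {x : A1 k} (hx : x.IsType23) : 0 < x.diam := by
  obtain ⟨β, r, hr, rfl⟩ := hx.exists_eq
  exact hr.trans_le (le_diam_discPoint β hr)

/-- Gauss points of large radius provide the common upper bounds needed for joins. -/
theorem A1.le_discPoint_zero (x : A1 k) {r : ℝ} (hr : 0 < r) (h : x.val X ≤ r) :
    x ≤ discPoint 0 hr := fun f => by
  have hcoef (i : ℕ) : x.val (C (f.coeff i) * X ^ i) ≤ (discPoint 0 hr).val f := by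
    have h1 := le_gaussNorm (spectralAbv k) (expansion 0 f) hr.le i
    rw [discPoint_val]
    refine le_trans ?_ h1
    rw [expansion, taylor_zero, coeff_map, spectralAbv_algebraMap, A1.val_mul, A1.val_C, A1.val_pow]
    gcongr
    exact x.val_nonneg _
  have hsum (s : Finset ℕ) :
      x.val (∑ i ∈ s, C (f.coeff i) * X ^ i) ≤ (discPoint 0 hr).val f := by
    induction s using Finset.cons_induction with
    | empty => simpa using A1.val_nonneg _ f
    | cons i s hi ih =>
      rw [Finset.sum_cons]
      exact (x.val_add_le _ _).trans (max_le (hcoef i) ih)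
  conv_lhs => rw [f.as_sum_support_C_mul_X_pow]
  exact hsum _

/-- Any two points have a join. -/
theorem A1.exists_isLUB (x y : A1 k) : ∃ j, IsLUB {x, y} j := by
  have hr : 0 < max 1 (max (x.val X) (y.val X)) := lt_max_of_lt_left one_pos
  exact A1.exists_isLUB_pair
    (x.le_discPoint_zero hr ((le_max_left _ _).trans (le_max_right _ _)))
    (y.le_discPoint_zero hr ((le_max_right _ _).trans (le_max_right _ _)))

theorem continuous_discPoint (β : AlgebraicClosure k) {r : ℝ} (hr : 0 < r) :
    Continuous fun s : Set.Ici r => discPoint β (hr.trans_le s.2) := by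
  refine A1.continuous_iff.2 fun f => ?_
  have heq (s : Set.Ici r) : (discPoint β (hr.trans_le s.2)).val f =
      (expansion β f).gaussNorm (spectralAbv k) s := rfl
  simp only [heq, gaussNorm]
  split_ifs with h
  · refine Continuous.finset_sup'_apply h fun i _ => ?_
    fun_prop
  · exact continuous_const

theorem continuous_diam_discPoint (β : AlgebraicClosure k) {r : ℝ} (hr : 0 < r) :
    Continuous fun s : Set.Ici r => (discPoint β (hr.trans_le s.2)).diam := by
  rw [continuous_iff_continuousAt]
  intro s
  have hs : 0 < (s : ℝ) := hr.trans_le s.2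
  set D := (discPoint β hs).diam with hD
  have hD0 : 0 < D := hs.trans_le (le_diam_discPoint β hs)
  have hc1 : Continuous fun u : Set.Ici r => min 1 (u / s : ℝ) * D := by fun_prop
  have hc2 : Continuous fun u : Set.Ici r => max 1 (u / s : ℝ) * D := by fun_prop
  refine tendsto_of_tendsto_of_tendsto_of_le_of_le
    (by simpa [ContinuousAt, div_self hs.ne'] using hc1.continuousAt (x := s))
    (by simpa [ContinuousAt, div_self hs.ne'] using hc2.continuousAt (x := s)) ?_ ?_
  · intro u
    have hu : 0 < (u : ℝ) := hr.trans_le u.2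
    rcases le_total (u : ℝ) s with h | h
    · have h1 := diam_discPoint_le β hu hs h
      have h2 : (u : ℝ) / s * D ≤ (discPoint β hu).diam := by
        rw [div_mul_eq_mul_div, div_le_iff₀ hs, mul_comm _ (s : ℝ)]
        rw [div_mul_eq_mul_div, le_div_iff₀ hu] at h1
        linarith
      exact (mul_le_mul_of_nonneg_right (min_le_right _ _) hD0.le).trans h2
    · refine (mul_le_mul_of_nonneg_right (min_le_left _ _) hD0.le).trans ?_
      rw [one_mul]
      exact A1.diam_mono (discPoint_mono β hs hu h)
  · intro u
    have hu : 0 < (u : ℝ) := hr.trans_le u.2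
    rcases le_total (u : ℝ) s with h | h
    · refine le_trans ?_ (mul_le_mul_of_nonneg_right (le_max_left _ _) hD0.le)
      rw [one_mul]
      exact A1.diam_mono (discPoint_mono β hu hs h)
    · exact (diam_discPoint_le β hs hu h).trans
        (mul_le_mul_of_nonneg_right (le_max_right _ _) hD0.le)

/-- The points above `η_{β,r}` form a half-line, parametrized by the diameter. -/
theorem A1.IsType23.exists_ray {x : A1 k} (hx : x.IsType23) :
    ∃ γ : Set.Ici x.diam → A1 k, Continuous γ ∧ ∀ d, x ≤ γ d ∧ (γ d).diam = d := by
  obtain ⟨β, r, hr, rfl⟩ := hx.exists_eq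
  let E : Set.Ici r → A1 k := fun s => discPoint β (hr.trans_le s.2)
  have hE (s : Set.Ici r) : discPoint β hr ≤ E s := discPoint_mono β hr _ s.2
  let D : Set.Ici r → Set.Ici (discPoint β hr).diam := fun s => ⟨(E s).diam, A1.diam_mono (hE s)⟩
  have hDs : Function.Surjective D := by
    have : PreconnectedSpace (Set.Ici r) := Subtype.preconnectedSpace isPreconnected_Ici
    rintro ⟨d, hd⟩
    have hmem : d ∈ Set.Icc (E ⟨r, Set.self_mem_Ici⟩).diam
        (E ⟨max r d, Set.mem_Ici.2 (le_max_left _ _)⟩).diam :=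
      ⟨hd, (le_max_right r d).trans (le_diam_discPoint β _)⟩
    obtain ⟨s, hs⟩ := mem_range_of_exists_le_of_exists_ge (continuous_diam_discPoint β hr)
      ⟨_, hmem.1⟩ ⟨_, hmem.2⟩
    exact ⟨s, Subtype.ext hs⟩
  have hvalmono (s t : Set.Ici r) (h : s ≤ t) : E s ≤ E t := discPoint_mono β _ _ h
  have hmono : StrictMono D := by
    intro s t h
    refine A1.diam_lt_diam (hvalmono s t h.le) fun heq => ?_
    exact discPoint_ne β (hr.trans_le s.2) (hr.trans_le t.2) h heq
  -- An order isomorphism is a homeomorphism for the order topologies, so the reparametrization by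
  -- the diameter is continuous.
  let e := hmono.orderIsoOfSurjective D hDs
  refine ⟨fun d => E (e.symm d), (continuous_discPoint β hr).comp e.symm.continuous,
    fun d => ⟨hE _, ?_⟩⟩
  exact congrArg Subtype.val (e.apply_symm_apply d)

end Disc

/-! ### Path lengths and bridges in the tree. -/

section Tree

variable [IsUltrametricDist k] [CompleteSpace k]

instance : SemilatticeSup (A1 k) where
  sup x y := (A1.exists_isLUB x y).choose
  le_sup_left x y := (A1.exists_isLUB x y).choose_spec.1 (by simp)
  le_sup_right x y := (A1.exists_isLUB x y).choose_spec.1 (by simp)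
  sup_le x y z hx hy := (A1.exists_isLUB x y).choose_spec.2 (by
    rintro w (rfl | rfl)
    exacts [hx, hy])

namespace A1

theorem sup_eq_diam_join (x y : A1 k) : x.sup y = (x ⊔ y).diam := sup_eq_of_isLUB isLUB_pair

theorem length_eq (x y : A1 k) :
    x.length y = 2 * Real.log (x ⊔ y).diam - Real.log x.diam - Real.log y.diam := by
  rw [length, sup_eq_diam_join]

theorem length_comm (x y : A1 k) : x.length y = y.length x := by
  rw [length_eq, length_eq, sup_comm]
  ring

theorem length_self (x : A1 k) : x.length x = 0 := by
  rw [length_eq, sup_idem]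
  ring

theorem length_of_le {x y : A1 k} (h : x ≤ y) :
    x.length y = Real.log y.diam - Real.log x.diam := by
  rw [length_eq, sup_eq_right.2 h]
  ring

theorem length_nonneg {x y : A1 k} (hx : 0 < x.diam) (hy : 0 < y.diam) : 0 ≤ x.length y := by
  rw [length_eq]
  have h1 := log_diam_mono hx (le_sup_left : x ≤ x ⊔ y)
  have h2 := log_diam_mono hy (le_sup_right : y ≤ x ⊔ y)
  linarith

theorem eq_of_length_eq_zero {x y : A1 k} (hx : 0 < x.diam) (hy : 0 < y.diam)
    (h : x.length y = 0) : x = y := by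
  rw [length_eq] at h
  have h1 := log_diam_mono hx (le_sup_left : x ≤ x ⊔ y)
  have h2 := log_diam_mono hy (le_sup_right : y ≤ x ⊔ y)
  exact (eq_of_log_diam_eq hx le_rfl le_sup_left (by linarith)).trans
    (eq_of_log_diam_eq hy le_rfl le_sup_right (by linarith)).symm

theorem mem_segment {x y z : A1 k} : z ∈ x.segment y ↔ (x ≤ z ∨ y ≤ z) ∧ z ≤ x ⊔ y :=
  and_congr_right fun _ =>
    ⟨fun h => h _ le_sup_left le_sup_right, fun h _ hx hy => h.trans (sup_le hx hy)⟩

theorem segment_comm (x y : A1 k) : x.segment y = y.segment x := by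
  ext z
  rw [mem_segment, mem_segment, sup_comm, or_comm]

theorem left_mem_segment (x y : A1 k) : x ∈ x.segment y :=
  mem_segment.2 ⟨Or.inl le_rfl, le_sup_left⟩

theorem diam_pos_of_mem_segment {x y z : A1 k} (hx : 0 < x.diam) (hy : 0 < y.diam)
    (hz : z ∈ x.segment y) : 0 < z.diam := by
  rcases (mem_segment.1 hz).1 with h | h
  · exact hx.trans_le (diam_mono h)
  · exact hy.trans_le (diam_mono h)

/-- Both `x ⊔ y` and `a` lie on the chain above `x`, and `x ⊔ y ≤ a` is excluded: the path from `x`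
to `y` climbs through `a`. -/
theorem sup_eq_sup_of_not_le {x y a : A1 k} (hxa : x ≤ a) (hya : ¬ y ≤ a) : x ⊔ y = a ⊔ y := by
  refine le_antisymm (sup_le_sup_right hxa y) (sup_le ?_ le_sup_right)
  rcases le_total_of_le (le_sup_left : x ≤ x ⊔ y) hxa with h | h
  · exact absurd (le_sup_right.trans h) hya
  · exact h

/-- On a segment, the length is the distance of the arc length coordinates. -/
theorem length_eq_abs_sub {p q x y : A1 k} (hp : 0 < p.diam) (hq : 0 < q.diam)
    (hx : x ∈ p.segment q) (hy : y ∈ p.segment q) :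
    x.length y = |p.length x - p.length y| := by
  have chain {o u v : A1 k} (ho : 0 < o.diam) (hu : o ≤ u) (hv : o ≤ v) :
      u.length v = |Real.log u.diam - Real.log v.diam| := by
    rcases le_total_of_le hu hv with h | h
    · rw [length_of_le h, abs_sub_comm, abs_of_nonneg]
      linarith [log_diam_mono (ho.trans_le (diam_mono hu)) h]
    · rw [length_comm, length_of_le h, abs_of_nonneg]
      linarith [log_diam_mono (ho.trans_le (diam_mono hv)) h]
  have right {u : A1 k} (hu : q ≤ u) (hu' : u ≤ p ⊔ q) :
      p.length u = 2 * Real.log (p ⊔ q).diam - Real.log p.diam - Real.log u.diam := by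
    rw [length_eq, le_antisymm (sup_le le_sup_left hu') (sup_le_sup_left hu p)]
  -- On opposite legs, the path between the two points passes through the top of the segment.
  have mixed {u v : A1 k} (hu : p ≤ u) (hu' : u ≤ p ⊔ q) (hv : q ≤ v) (hv' : v ≤ p ⊔ q) :
      u.length v = |p.length u - p.length v| := by
    have hj : u ⊔ v = p ⊔ q := le_antisymm (sup_le hu' hv') (sup_le_sup hu hv)
    have h1 := log_diam_mono (hp.trans_le (diam_mono hu)) hu'
    have h2 := log_diam_mono (hq.trans_le (diam_mono hv)) hv'
    rw [length_of_le hu, right hv hv', length_eq, hj, abs_sub_comm, abs_of_nonneg] <;> linarith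
  obtain ⟨hx1, hx2⟩ := mem_segment.1 hx
  obtain ⟨hy1, hy2⟩ := mem_segment.1 hy
  rcases hx1 with hx1 | hx1 <;> rcases hy1 with hy1 | hy1
  · rw [chain hp hx1 hy1, length_of_le hx1, length_of_le hy1]
    congr 1
    ring
  · exact mixed hx1 hx2 hy1 hy2
  · rw [length_comm, abs_sub_comm]
    exact mixed hy1 hy2 hx1 hx2
  · rw [chain hq hx1 hy1, right hx1 hx2, right hy1 hy2, abs_sub_comm]
    congr 1
    ring

theorem eq_of_length_eq {p q x y : A1 k} (hp : 0 < p.diam) (hq : 0 < q.diam)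
    (hx : x ∈ p.segment q) (hy : y ∈ p.segment q) (h : p.length x = p.length y) : x = y :=
  eq_of_length_eq_zero (diam_pos_of_mem_segment hp hq hx) (diam_pos_of_mem_segment hp hq hy)
    (by rw [length_eq_abs_sub hp hq hx hy, h, sub_self, abs_zero])

theorem length_add_length {p q x : A1 k} (hx : x ∈ p.segment q) :
    p.length x + x.length q = p.length q := by
  obtain ⟨hx1, hx2⟩ := mem_segment.1 hx
  rcases hx1 with h | h
  · have hj : x ⊔ q = p ⊔ q := le_antisymm (sup_le hx2 le_sup_right) (sup_le_sup_right h q)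
    rw [length_of_le h, length_eq, length_eq, hj]
    ring
  · have hj : p ⊔ x = p ⊔ q := le_antisymm (sup_le le_sup_left hx2) (sup_le_sup_left h p)
    rw [length_comm x q, length_of_le h, length_eq, length_eq, hj]
    ring

/-- `z` and `w` are the ends of a bridge between the sets `S` and `T`. -/
def IsBridge (S T : Set (A1 k)) (z w : A1 k) : Prop :=
  z ∈ S ∧ w ∈ T ∧ ∀ x ∈ S, ∀ y ∈ T, x.length y = x.length z + z.length w + w.length y

theorem IsBridge.symm {S T : Set (A1 k)} {z w : A1 k} (h : IsBridge S T z w) :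
    IsBridge T S w z := by
  refine ⟨h.2.1, h.1, fun y hy x hx => ?_⟩
  rw [length_comm, h.2.2 x hx y hy, length_comm x z, length_comm z w, length_comm w y]
  ring

/-- The path up from the top `j` of the first segment enters the second one at the lower of `p' ⊔ j`
and `q' ⊔ j`, the other being the top `p' ⊔ q'`. The bridge joins `j` to this entry point. -/
theorem exists_isBridge_of_sup_le_sup {p q p' q' : A1 k}
    (h : (p.segment q ∩ p'.segment q').Subsingleton) (hj : p ⊔ q ≤ p' ⊔ q')
    (hle : p' ⊔ (p ⊔ q) ≤ q' ⊔ (p ⊔ q)) :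
    ∃ z w, IsBridge (p.segment q) (p'.segment q') z w := by
  set j := p ⊔ q with hjdef
  set m := p' ⊔ j with hm
  have hq'j : q' ⊔ j = p' ⊔ q' := le_antisymm (sup_le le_sup_right hj)
    (sup_le ((le_sup_left : p' ≤ m).trans hle) le_sup_left)
  have hmJ : m ∈ p'.segment q' := mem_segment.2 ⟨Or.inl le_sup_left, hle.trans hq'j.le⟩
  have hjI : j ∈ p.segment q := mem_segment.2 ⟨Or.inl le_sup_left, le_rfl⟩
  refine ⟨j, m, hjI, hmJ, fun x hx y hy => ?_⟩
  obtain ⟨hx1, hx2⟩ := mem_segment.1 hx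
  obtain ⟨hy1, hy2⟩ := mem_segment.1 hy
  suffices hsup : x ⊔ y = m ⊔ y by
    rw [length_of_le hx2, length_of_le (le_sup_right : j ≤ m), length_eq, length_eq, hsup]
    ring
  -- If `y ≤ j`, then `m = j`, and both `x ⊔ y` and `j` lie on the two segments; this is where
  -- meeting in at most one point matters.
  by_cases hyj : y ≤ j
  · have hmj : m = j := by
      refine le_antisymm ?_ le_sup_right
      rcases hy1 with hy1 | hy1
      · exact sup_le (hy1.trans hyj) le_rfl
      · exact hle.trans (sup_le (hy1.trans hyj) le_rfl)
    have hcj : x ⊔ y ≤ j := sup_le hx2 hyj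
    rw [hmj, sup_eq_left.2 hyj]
    exact h ⟨mem_segment.2 ⟨hx1.imp (·.trans le_sup_left) (·.trans le_sup_left), hcj⟩,
      mem_segment.2 ⟨hy1.imp (·.trans le_sup_right) (·.trans le_sup_right), hcj.trans hj⟩⟩
      ⟨hjI, hmj ▸ hmJ⟩
  · rw [sup_eq_sup_of_not_le hx2 hyj]
    refine le_antisymm (sup_le_sup_right le_sup_right y) (sup_le (sup_le ?_ le_sup_left)
      le_sup_right)
    rcases hy1 with hy1 | hy1
    · exact hy1.trans le_sup_right
    · refine le_trans ?_ (sup_le (hy1.trans le_sup_right) le_sup_left : q' ⊔ j ≤ j ⊔ y)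
      exact hq'j ▸ le_sup_left

theorem exists_isBridge_of_sup_le {p q p' q' : A1 k}
    (h : (p.segment q ∩ p'.segment q').Subsingleton) (hj : p ⊔ q ≤ p' ⊔ q') :
    ∃ z w, IsBridge (p.segment q) (p'.segment q') z w := by
  rcases le_total_of_le (le_sup_right : p ⊔ q ≤ p' ⊔ (p ⊔ q))
    (le_sup_right : p ⊔ q ≤ q' ⊔ (p ⊔ q)) with hle | hle
  · exact exists_isBridge_of_sup_le_sup h hj hle
  · rw [segment_comm p' q'] at h ⊢
    exact exists_isBridge_of_sup_le_sup h (by rwa [sup_comm q' p']) hle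

/-- Two segments that meet in at most one point are joined by a bridge. -/
theorem exists_isBridge {p q p' q' : A1 k} (h : (p.segment q ∩ p'.segment q').Subsingleton) :
    ∃ z w, IsBridge (p.segment q) (p'.segment q') z w := by
  by_cases h1 : p ⊔ q ≤ p' ⊔ q'
  · exact exists_isBridge_of_sup_le h h1
  by_cases h2 : p' ⊔ q' ≤ p ⊔ q
  · obtain ⟨w, z, hb⟩ := exists_isBridge_of_sup_le (Set.inter_comm _ _ ▸ h) h2
    exact ⟨z, w, hb.symm⟩
  -- If the tops are incomparable, no point lies below both, and every path between the segments
  -- runs through both tops.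
  refine ⟨p ⊔ q, p' ⊔ q', mem_segment.2 ⟨Or.inl le_sup_left, le_rfl⟩,
    mem_segment.2 ⟨Or.inl le_sup_left, le_rfl⟩, fun x hx y hy => ?_⟩
  have hx := (mem_segment.1 hx).2
  have hy := (mem_segment.1 hy).2
  have hyj : ¬ y ≤ p ⊔ q := fun hle => (le_total_of_le hle hy).elim h1 h2
  have hsup : x ⊔ y = (p ⊔ q) ⊔ (p' ⊔ q') := by
    rw [sup_eq_sup_of_not_le hx hyj, sup_comm, sup_eq_sup_of_not_le hy h1, sup_comm]
  rw [length_of_le hx, length_comm (p' ⊔ q') y, length_of_le hy, length_eq, length_eq, hsup]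
  ring

theorem IsType23.exists_log_ray {x : A1 k} (hx : x.IsType23) :
    ∃ γ : ℝ → A1 k, Continuous γ ∧
      ∀ t, x ≤ γ t ∧ Real.log (γ t).diam = Real.log x.diam + max t 0 := by
  obtain ⟨ρ, hρ, h⟩ := hx.exists_ray
  have hle (t : ℝ) : Real.exp (Real.log x.diam + max t 0) ∈ Set.Ici x.diam := by
    rw [Set.mem_Ici, ← Real.log_le_iff_le_exp hx.diam_pos]
    linarith [le_max_right t 0]
  refine ⟨fun t => ρ ⟨_, hle t⟩, by fun_prop, fun t => ⟨(h _).1, ?_⟩⟩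
  rw [(h _).2, Real.log_exp]

end A1

/-! ### Arc length parametrization of segments. -/

namespace Seg

variable (I : Seg k)

theorem length_nonneg : 0 ≤ I.length := A1.length_nonneg I.hp.diam_pos I.hq.diam_pos

theorem length_eq_zero_iff : I.length = 0 ↔ I.p = I.q :=
  ⟨fun h => A1.eq_of_length_eq_zero I.hp.diam_pos I.hq.diam_pos h, fun h => by
    rw [Seg.length, h, A1.length_self]⟩

theorem length_mem_Icc {z : A1 k} (hz : z ∈ I.carrier) : I.p.length z ∈ Set.Icc 0 I.length := by
  have hz0 := A1.diam_pos_of_mem_segment I.hp.diam_pos I.hq.diam_pos hz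
  have h1 := A1.length_nonneg I.hp.diam_pos hz0
  have h2 := A1.length_nonneg hz0 I.hq.diam_pos
  exact ⟨h1, by rw [Seg.length, ← A1.length_add_length hz]; linarith⟩

/-- Every segment has a continuous arc length parametrization. -/
theorem exists_path : ∃ γ : ℝ → A1 k, Continuous γ ∧
    (∀ t ∈ Set.Icc 0 I.length, γ t ∈ I.carrier ∧ I.p.length (γ t) = t) ∧
    Continuous fun t => Real.log (γ t).diam := by
  obtain ⟨ρ, hρ, hpρ⟩ := I.hp.exists_log_ray
  obtain ⟨ρ', hρ', hqρ'⟩ := I.hq.exists_log_ray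
  set j := I.p ⊔ I.q with hj
  set a := Real.log j.diam - Real.log I.p.diam with ha
  have ha0 : 0 ≤ a := by
    linarith [A1.log_diam_mono I.hp.diam_pos (le_sup_left : I.p ≤ I.p ⊔ I.q)]
  have hb0 : 0 ≤ I.length - a := by
    rw [Seg.length, A1.length_eq]
    linarith [A1.log_diam_mono I.hq.diam_pos (le_sup_right : I.q ≤ I.p ⊔ I.q)]
  have hb : Real.log I.q.diam + (I.length - a) = Real.log j.diam := by
    rw [Seg.length, A1.length_eq]
    linarith
  have hρa : ρ a = j := A1.eq_of_log_diam_eq I.hp.diam_pos (hpρ a).1 le_sup_left (by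
    rw [(hpρ a).2, max_eq_left ha0]
    linarith)
  have hρ'b : ρ' (I.length - a) = j :=
    A1.eq_of_log_diam_eq I.hq.diam_pos (hqρ' _).1 le_sup_right (by
      rw [(hqρ' _).2, max_eq_left hb0, hb])
  -- Climb the ray above `p` up to the join, reached at time `a`, then follow the ray above `q`
  -- backwards.
  refine ⟨fun t => if t ≤ a then ρ t else ρ' (I.length - t), ?_, ?_, ?_⟩
  · refine Continuous.if_le hρ (by fun_prop) continuous_id continuous_const fun t ht => ?_
    rw [show t = a from ht, hρa, hρ'b]
  · rintro t ⟨ht0, ht1⟩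
    dsimp only
    split_ifs with hta
    · have hle : ρ t ≤ j := by
        rw [← hρa]
        refine A1.le_of_diam_le (hpρ t).1 (hpρ a).1 ?_
        rw [← Real.log_le_log_iff (I.hp.diam_pos.trans_le (A1.diam_mono (hpρ t).1))
          (I.hp.diam_pos.trans_le (A1.diam_mono (hpρ a).1)), (hpρ t).2, (hpρ a).2]
        gcongr
      refine ⟨A1.mem_segment.2 ⟨Or.inl (hpρ t).1, hle⟩, ?_⟩
      rw [A1.length_of_le (hpρ t).1, (hpρ t).2, max_eq_left ht0]
      ring
    · have hle : ρ' (I.length - t) ≤ j := by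
        rw [← hρ'b]
        refine A1.le_of_diam_le (hqρ' _).1 (hqρ' _).1 ?_
        rw [← Real.log_le_log_iff (I.hq.diam_pos.trans_le (A1.diam_mono (hqρ' _).1))
          (I.hq.diam_pos.trans_le (A1.diam_mono (hqρ' _).1)), (hqρ' _).2, (hqρ' _).2]
        gcongr
        exact (not_le.1 hta).le
      have hmem : ρ' (I.length - t) ∈ I.p.segment I.q :=
        A1.mem_segment.2 ⟨Or.inr (hqρ' _).1, hle⟩
      refine ⟨hmem, ?_⟩
      have h1 := A1.length_add_length hmem
      rw [A1.length_comm _ I.q, A1.length_of_le (hqρ' _).1, (hqρ' _).2,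
        max_eq_left (by linarith)] at h1
      have h2 : I.p.length I.q = I.length := rfl
      linarith
  · have heq (t : ℝ) : Real.log (if t ≤ a then ρ t else ρ' (I.length - t)).diam =
        if t ≤ a then Real.log I.p.diam + max t 0
        else Real.log I.q.diam + max (I.length - t) 0 := by
      split_ifs
      · exact (hpρ t).2
      · exact (hqρ' _).2
    simp only [heq]
    refine Continuous.if_le (by fun_prop) (by fun_prop) continuous_id continuous_const
      fun t ht => ?_
    rw [show t = a from ht, max_eq_left ha0, max_eq_left hb0, hb]
    linarith

/-- The arc length parametrization, as a continuous path. -/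
def path : ℝ → A1 k := I.exists_path.choose

theorem continuous_path : Continuous I.path := I.exists_path.choose_spec.1

theorem continuous_log_diam_path : Continuous fun t => Real.log (I.path t).diam :=
  I.exists_path.choose_spec.2.2

theorem path_mem {t : ℝ} (ht : t ∈ Set.Icc 0 I.length) : I.path t ∈ I.carrier :=
  (I.exists_path.choose_spec.2.1 t ht).1

theorem length_path {t : ℝ} (ht : t ∈ Set.Icc 0 I.length) : I.p.length (I.path t) = t :=
  (I.exists_path.choose_spec.2.1 t ht).2

theorem path_length {z : A1 k} (hz : z ∈ I.carrier) : I.path (I.p.length z) = z :=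
  A1.eq_of_length_eq I.hp.diam_pos I.hq.diam_pos (I.path_mem (I.length_mem_Icc hz)) hz
    (I.length_path (I.length_mem_Icc hz))

/-- Arc length is injective on the segment, so the choice made in `Seg.param` is forced. -/
theorem param_eq_path {t : ℝ} (ht : t ∈ Set.Icc 0 I.length) : I.param t = (I.path t : P1 k) := by
  have : Nonempty (A1 k) := ⟨I.p⟩
  have hex : ∃ z ∈ I.carrier, I.p.length z = t := ⟨_, I.path_mem ht, I.length_path ht⟩
  refine congrArg _ (A1.eq_of_length_eq I.hp.diam_pos I.hq.diam_pos
    (Function.invFunOn_mem hex) (I.path_mem ht) ?_)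
  exact (Function.invFunOn_eq hex).trans (I.length_path ht).symm

theorem length_path_path {s t : ℝ} (hs : s ∈ Set.Icc 0 I.length) (ht : t ∈ Set.Icc 0 I.length) :
    (I.path s).length (I.path t) = |s - t| := by
  rw [A1.length_eq_abs_sub I.hp.diam_pos I.hq.diam_pos (I.path_mem hs) (I.path_mem ht),
    I.length_path hs, I.length_path ht]

end Seg

end Tree

/-! ### Jordan parts of a difference of finite measures. -/

section Jordan

variable {α : Type*} [MeasurableSpace α]

/-- On a set carrying `p` and null for `n`, the identity reads `p + ν = μ`. -/
theorem le_of_add_eq_add_of_mutuallySingular {p n μ ν : Measure α} (h : p + ν = n + μ)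
    (hs : p ⟂ₘ n) : p ≤ μ := by
  obtain ⟨S, hS, hp, hn⟩ := hs
  refine Measure.le_iff.2 fun A hA => ?_
  have h1 : p A ≤ p (A ∩ Sᶜ) := by
    rw [← measure_inter_add_sdiff A hS, ← Set.sdiff_eq]
    simp [measure_mono_null (Set.inter_subset_right (s := A)) hp]
  have h2 : p (A ∩ Sᶜ) + ν (A ∩ Sᶜ) = n (A ∩ Sᶜ) + μ (A ∩ Sᶜ) := by
    rw [← Measure.add_apply, h, Measure.add_apply]
  rw [measure_mono_null (Set.inter_subset_right (s := A)) hn, zero_add] at h2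
  exact h1.trans ((le_self_add.trans h2.le).trans (measure_mono Set.inter_subset_left))

theorem posPart_add_eq_negPart_add (μ ν : Measure α) [IsFiniteMeasure μ] [IsFiniteMeasure ν] :
    (μ.toSignedMeasure - ν.toSignedMeasure).toJordanDecomposition.posPart + ν =
      (μ.toSignedMeasure - ν.toSignedMeasure).toJordanDecomposition.negPart + μ := by
  set j := (μ.toSignedMeasure - ν.toSignedMeasure).toJordanDecomposition with hj
  have h : j.posPart.toSignedMeasure - j.negPart.toSignedMeasure =
      μ.toSignedMeasure - ν.toSignedMeasure :=
    SignedMeasure.toSignedMeasure_toJordanDecomposition _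
  rw [← Measure.toSignedMeasure_eq_toSignedMeasure_iff, Measure.toSignedMeasure_add,
    Measure.toSignedMeasure_add, ← sub_eq_zero]
  rw [← sub_eq_zero] at h
  rw [← h]
  abel

end Jordan

/-! ### Bilinear expansion of the energy. -/

section Energy

/-- The Jordan parts are dominated by `μ` and `ν`, which gives integrability. The relation `posPart
+ ν = negPart + μ`, applied to one variable and then to the other, exchanges the Jordan parts for
`μ` and `ν`. -/
theorem energy_toSignedMeasure_sub (μ ν : Measure (P1 k)) [IsFiniteMeasure μ] [IsFiniteMeasure ν]
    (hμμ : Integrable logKernel (μ.prod μ)) (hμν : Integrable logKernel (μ.prod ν))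
    (hνμ : Integrable logKernel (ν.prod μ)) (hνν : Integrable logKernel (ν.prod ν)) :
    EnergyDefined (μ.toSignedMeasure - ν.toSignedMeasure)
        (μ.toSignedMeasure - ν.toSignedMeasure) ∧
      energy (μ.toSignedMeasure - ν.toSignedMeasure) (μ.toSignedMeasure - ν.toSignedMeasure) =
        kernelIntegral μ ν + kernelIntegral ν μ - kernelIntegral μ μ - kernelIntegral ν ν := by
  have hadd := posPart_add_eq_negPart_add μ ν
  set j := (μ.toSignedMeasure - ν.toSignedMeasure).toJordanDecomposition with hj
  have hp : j.posPart ≤ μ := le_of_add_eq_add_of_mutuallySingular hadd j.mutuallySingular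
  have hn : j.negPart ≤ ν := le_of_add_eq_add_of_mutuallySingular hadd.symm j.mutuallySingular.symm
  have hpτ : j.posPart ≤ μ + ν := hp.trans (Measure.le_add_right le_rfl)
  have hnτ : j.negPart ≤ μ + ν := hn.trans (Measure.le_add_left le_rfl)
  have hμτ : μ ≤ μ + ν := (Measure.le_add_right le_rfl)
  have hντ : ν ≤ μ + ν := (Measure.le_add_left le_rfl)
  have hint : Integrable logKernel ((μ + ν).prod (μ + ν)) := by
    rw [Measure.prod_add, Measure.add_prod, Measure.add_prod]
    exact (hμμ.add_measure hνμ).add_measure (hμν.add_measure hνν)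
  have hI {σ τ : Measure (P1 k)} [IsFiniteMeasure τ] (hσ : σ ≤ μ + ν) (hτ : τ ≤ μ + ν) :
      Integrable logKernel (σ.prod τ) := hint.mono_measure (Measure.prod_mono hσ hτ)
  have left {σ : Measure (P1 k)} [IsFiniteMeasure σ] (hσ : σ ≤ μ + ν) :
      kernelIntegral j.posPart σ + kernelIntegral ν σ =
        kernelIntegral j.negPart σ + kernelIntegral μ σ := by
    unfold kernelIntegral
    rw [← integral_add_measure (hI hpτ hσ) (hI hντ hσ),
      ← integral_add_measure (hI hnτ hσ) (hI hμτ hσ), ← Measure.add_prod, ← Measure.add_prod, hadd]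
  have right {σ : Measure (P1 k)} [IsFiniteMeasure σ] (hσ : σ ≤ μ + ν) :
      kernelIntegral σ j.posPart + kernelIntegral σ ν =
        kernelIntegral σ j.negPart + kernelIntegral σ μ := by
    unfold kernelIntegral
    rw [← integral_add_measure (hI hσ hpτ) (hI hσ hντ),
      ← integral_add_measure (hI hσ hnτ) (hI hσ hμτ), ← Measure.prod_add, ← Measure.prod_add, hadd]
  constructor
  · refine hint.mono_measure (Measure.prod_mono ?_ ?_) <;>
      exact add_le_add hp hn
  · unfold energy
    rw [← hj]
    linarith [left hpτ, left hnτ, right hμτ, right hντ]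

end Energy

/-! ### Mean distances on an interval. -/

section Arc

/-- The uniform probability measure on `[0, ℓ]`, a Dirac measure if `ℓ = 0`. -/
def arcMeasure (ℓ : ℝ) : Measure (Set.Icc 0 ℓ) :=
  if h : ℓ = 0 then Measure.dirac ⟨0, Set.left_mem_Icc.2 h.ge⟩
  else ENNReal.ofReal ℓ⁻¹ • Measure.comap Subtype.val volume

theorem integral_arcMeasure_zero {ℓ : ℝ} (h : ℓ = 0) (f : ℝ → ℝ) :
    ∫ t, f t ∂(arcMeasure ℓ) = f 0 := by
  rw [arcMeasure, dif_pos h, integral_dirac]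

theorem integral_arcMeasure {ℓ : ℝ} (h : 0 < ℓ) (f : ℝ → ℝ) :
    ∫ t, f t ∂(arcMeasure ℓ) = ℓ⁻¹ * ∫ t in 0..ℓ, f t := by
  rw [arcMeasure, dif_neg h.ne', integral_smul_measure, integral_subtype_comap measurableSet_Icc,
    integral_Icc_eq_integral_Ioc, intervalIntegral.integral_of_le h.le,
    ENNReal.toReal_ofReal (inv_nonneg.2 h.le), smul_eq_mul]

theorem isProbabilityMeasure_arcMeasure {ℓ : ℝ} (h : 0 ≤ ℓ) :
    IsProbabilityMeasure (arcMeasure ℓ) := by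
  unfold arcMeasure
  split_ifs with h0
  · infer_instance
  · refine ⟨?_⟩
    have hpos : 0 < ℓ := h.lt_of_ne' h0
    rw [Measure.smul_apply, comap_subtype_coe_apply measurableSet_Icc, Set.image_univ,
      Subtype.range_coe, Real.volume_Icc, sub_zero, smul_eq_mul, ← ENNReal.ofReal_mul
      (inv_nonneg.2 h), inv_mul_cancel₀ h0, ENNReal.ofReal_one]

theorem intervalIntegral_abs_sub {ℓ a : ℝ} (ha : a ∈ Set.Icc 0 ℓ) :
    ∫ t in 0..ℓ, |t - a| = (a ^ 2 + (ℓ - a) ^ 2) / 2 := by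
  have hc (u v : ℝ) : IntervalIntegrable (fun t => |t - a|) volume u v :=
    Continuous.intervalIntegrable (by fun_prop) _ _
  rw [← intervalIntegral.integral_add_adjacent_intervals (hc 0 a) (hc a ℓ)]
  have h1 : ∫ t in 0..a, |t - a| = ∫ t in 0..a, (a - t) := by
    refine intervalIntegral.integral_congr fun t ht => ?_
    rw [Set.uIcc_of_le ha.1] at ht
    rw [abs_sub_comm, abs_of_nonneg (sub_nonneg.2 ht.2)]
  have h2 : ∫ t in a..ℓ, |t - a| = ∫ t in a..ℓ, (t - a) := by
    refine intervalIntegral.integral_congr fun t ht => ?_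
    rw [Set.uIcc_of_le ha.2] at ht
    rw [abs_of_nonneg (sub_nonneg.2 ht.1)]
  rw [h1, h2, intervalIntegral.integral_sub (by simp) (by simp),
    intervalIntegral.integral_sub (by simp) (by simp)]
  simp only [intervalIntegral.integral_const, integral_id, smul_eq_mul]
  ring

/-- Source of the quotients in the energy formula. For `ℓ = 0` the quotient is 0 by convention, in
agreement with the Dirac measure. -/
theorem integral_abs_sub_arcMeasure {ℓ a : ℝ} (ha : a ∈ Set.Icc 0 ℓ) :
    ∫ t, |(t : ℝ) - a| ∂(arcMeasure ℓ) = ℓ / 2 - a * (ℓ - a) / ℓ := by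
  rcases (ha.1.trans ha.2).eq_or_lt with h | h
  · rw [integral_arcMeasure_zero h.symm (fun t => |t - a|), ← h]
    have : a = 0 := le_antisymm (ha.2.trans h.ge) ha.1
    simp [this]
  · rw [integral_arcMeasure h (fun t => |t - a|), intervalIntegral_abs_sub ha]
    field_simp
    ring

theorem integral_abs_sub_arcMeasure_prod {ℓ : ℝ} (h : 0 ≤ ℓ) :
    ∫ z, |(z.1 : ℝ) - z.2| ∂((arcMeasure ℓ).prod (arcMeasure ℓ)) = ℓ / 3 := by
  have := isProbabilityMeasure_arcMeasure h
  have hcont : Continuous fun z : Set.Icc 0 ℓ × Set.Icc 0 ℓ => |(z.1 : ℝ) - z.2| := by fun_prop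
  rw [integral_prod _ (hcont.integrable_of_hasCompactSupport (HasCompactSupport.of_compactSpace _))]
  have hin (s : Set.Icc 0 ℓ) : ∫ t, |(s : ℝ) - (t : ℝ)| ∂(arcMeasure ℓ) =
      ℓ / 2 - s * (ℓ - s) / ℓ := by
    simp_rw [abs_sub_comm (s : ℝ)]
    exact integral_abs_sub_arcMeasure s.2
  simp only [hin]
  rcases h.eq_or_lt with h0 | h0
  · rw [integral_arcMeasure_zero h0.symm (fun s => ℓ / 2 - s * (ℓ - s) / ℓ), ← h0]
    simp
  · rw [integral_arcMeasure h0 (fun s => ℓ / 2 - s * (ℓ - s) / ℓ)]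
    have : ∀ s, ℓ / 2 - s * (ℓ - s) / ℓ = ℓ / 2 - s + ℓ⁻¹ * s ^ 2 := fun s => by
      field_simp
      ring
    simp only [this]
    rw [intervalIntegral.integral_add (Continuous.intervalIntegrable (by fun_prop) _ _)
        (Continuous.intervalIntegrable (by fun_prop) _ _),
      intervalIntegral.integral_sub (by simp) (by simp), intervalIntegral.integral_const_mul]
    simp only [intervalIntegral.integral_const, integral_id, integral_pow, smul_eq_mul]
    norm_num
    field_simp
    ring

end Arc

instance : T2Space (A1 k) :=
  T2Space.of_injective_continuous (f := A1.val)
    (fun _ _ h => A1.ext_val fun f => congrFun h f) continuous_induced_dom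

/-! ### Transport of the kernel integrals to rectangles. -/

namespace Seg

variable [IsUltrametricDist k] [CompleteSpace k] (I J : Seg k)

/-- The arc length parametrization of a segment of the projective line. -/
def arc (t : Set.Icc 0 I.length) : P1 k := (I.path t : P1 k)

/-- Closed subsets of the interval have compact images, closed in the Hausdorff line and hence in
its compactification. Integrals against a push-forward along an embedding can be pulled back without
knowing that `logKernel` is measurable. -/
theorem measurableEmbedding_arc : MeasurableEmbedding I.arc := by
  have hc : Continuous fun t : Set.Icc 0 I.length => I.path t :=
    I.continuous_path.comp continuous_subtype_val
  refine (Topology.IsClosedEmbedding.of_continuous_injective_isClosedMap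
    (OnePoint.continuous_coe.comp hc) ?_ ?_).measurableEmbedding
  · intro s t h
    have h' : I.path s = I.path t := OnePoint.coe_injective h
    refine Subtype.ext ?_
    rw [← I.length_path s.2, h', I.length_path t.2]
  · intro F hF
    rw [Set.image_comp]
    have hcomp := hF.isCompact.image hc
    exact OnePoint.isClosed_image_coe.2 ⟨hcomp.isClosed, hcomp⟩

theorem measure_eq_map : I.measure = Measure.map I.arc (arcMeasure I.length) := by
  unfold Seg.measure arcMeasure
  split_ifs with h h' h'
  · rw [Measure.map_dirac' I.measurableEmbedding_arc.measurable]
    congr 2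
    have h0 := I.path_length (A1.left_mem_segment I.p I.q)
    rw [A1.length_self] at h0
    exact h0.symm
  · exact absurd (I.length_eq_zero_iff.2 h) h'
  · exact absurd (I.length_eq_zero_iff.1 h') h
  · have hm : Measurable fun t => (I.path t : P1 k) :=
      (OnePoint.continuous_coe.comp I.continuous_path).measurable
    have hcongr : I.param =ᵐ[ENNReal.ofReal (I.length)⁻¹ •
        (volume : Measure ℝ).restrict (Set.Icc 0 I.length)] fun t => (I.path t : P1 k) :=
      Measure.ae_smul_measure ((ae_restrict_mem measurableSet_Icc).mono
        fun t ht => I.param_eq_path ht) _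
    rw [Measure.map_congr hcongr, Measure.map_smul, Measure.map_smul,
      ← map_comap_subtype_coe measurableSet_Icc, Measure.map_map hm measurable_subtype_coe]
    rfl

/-- Points of a segment have positive diameter, so the diagonal convention never intervenes; the
rest is the formula for the length solved for the kernel. -/
theorem logKernel_arc (s : Set.Icc 0 I.length) (t : Set.Icc 0 J.length) :
    logKernel (I.arc s, J.arc t) = 1 / 2 * ((I.path s).length (J.path t) +
      Real.log (I.path s).diam + Real.log (J.path t).diam) := by
  have hpos := A1.diam_pos_of_mem_segment I.hp.diam_pos I.hq.diam_pos (I.path_mem s.2)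
  have : logKernel (I.arc s, J.arc t) = Real.log ((I.path s).sup (J.path t)) :=
    if_neg fun h => hpos.ne' h.2
  rw [this, A1.length]
  ring

theorem logKernel_integral {F : ℝ × ℝ → ℝ} (hF : Continuous F)
    (h : ∀ s ∈ Set.Icc 0 I.length, ∀ t ∈ Set.Icc 0 J.length,
      (I.path s).length (J.path t) = F (s, t)) :
    Integrable logKernel (I.measure.prod J.measure) ∧
      kernelIntegral I.measure J.measure =
        1 / 2 * ((∫ z, F (z.1, z.2) ∂((arcMeasure I.length).prod (arcMeasure J.length))) +
          (∫ s, Real.log (I.path s).diam ∂(arcMeasure I.length)) +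
          ∫ t, Real.log (J.path t).diam ∂(arcMeasure J.length)) := by
  have := isProbabilityMeasure_arcMeasure I.length_nonneg
  have := isProbabilityMeasure_arcMeasure J.length_nonneg
  have hemb := I.measurableEmbedding_arc.prodMap J.measurableEmbedding_arc
  have hprod : I.measure.prod J.measure = Measure.map (Prod.map I.arc J.arc)
      ((arcMeasure I.length).prod (arcMeasure J.length)) := by
    rw [I.measure_eq_map, J.measure_eq_map, Measure.map_prod_map _ _
      I.measurableEmbedding_arc.measurable J.measurableEmbedding_arc.measurable]
  have hK : logKernel ∘ Prod.map I.arc J.arc = fun z : Set.Icc 0 I.length × Set.Icc 0 J.length =>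
      1 / 2 * (F (z.1, z.2) + Real.log (I.path z.1).diam + Real.log (J.path z.2).diam) := by
    ext z
    rw [← h z.1 z.1.2 z.2 z.2.2]
    exact I.logKernel_arc J z.1 z.2
  have c1 : Continuous fun z : Set.Icc 0 I.length × Set.Icc 0 J.length =>
      F (z.1, z.2) := by fun_prop
  have c2 : Continuous fun z : Set.Icc 0 I.length × Set.Icc 0 J.length =>
      Real.log (I.path z.1).diam :=
    I.continuous_log_diam_path.comp (by fun_prop : Continuous fun
      z : Set.Icc 0 I.length × Set.Icc 0 J.length => (z.1 : ℝ))
  have c3 : Continuous fun z : Set.Icc 0 I.length × Set.Icc 0 J.length =>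
      Real.log (J.path z.2).diam :=
    J.continuous_log_diam_path.comp (by fun_prop : Continuous fun
      z : Set.Icc 0 I.length × Set.Icc 0 J.length => (z.2 : ℝ))
  have hint {f : Set.Icc 0 I.length × Set.Icc 0 J.length → ℝ} (hf : Continuous f) :
      Integrable f ((arcMeasure I.length).prod (arcMeasure J.length)) :=
    hf.integrable_of_hasCompactSupport (HasCompactSupport.of_compactSpace _)
  constructor
  · rw [hprod, hemb.integrable_map_iff, hK]
    exact hint (by fun_prop)
  · unfold kernelIntegral
    rw [hprod, hemb.integral_map]
    have hK' := fun z => congrFun hK z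
    simp only [Function.comp_apply] at hK'
    simp only [hK']
    rw [integral_const_mul, integral_add (hint (c1.fun_add c2)) (hint c3),
      integral_add (hint c1) (hint c2),
      integral_fun_fst (fun s : Set.Icc 0 I.length => Real.log (I.path s).diam),
      integral_fun_snd (fun t : Set.Icc 0 J.length => Real.log (J.path t).diam)]
    simp

end Seg

/-! ### Nearest points and evaluation of the energy. -/

namespace Seg

variable [IsUltrametricDist k] [CompleteSpace k] {I J : Seg k}
  {z w : A1 k}

theorem diam_pos_of_mem (I : Seg k) {x : A1 k} (hx : x ∈ I.carrier) : 0 < x.diam :=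
  A1.diam_pos_of_mem_segment I.hp.diam_pos I.hq.diam_pos hx

theorem dist_eq_of_isBridge (h : A1.IsBridge I.carrier J.carrier z w) :
    I.dist J = z.length w := by
  have : Nonempty (I.carrier × J.carrier) := ⟨⟨z, h.1⟩, ⟨w, h.2.1⟩⟩
  refine le_antisymm (ciInf_le (f := fun u : I.carrier × J.carrier => u.1.1.length u.2.1) ⟨0, ?_⟩
    (⟨z, h.1⟩, ⟨w, h.2.1⟩)) (le_ciInf fun u => ?_)
  · rintro _ ⟨u, rfl⟩
    exact A1.length_nonneg (I.diam_pos_of_mem u.1.2) (J.diam_pos_of_mem u.2.2)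
  · rw [h.2.2 _ u.1.2 _ u.2.2]
    linarith [A1.length_nonneg (I.diam_pos_of_mem u.1.2) (I.diam_pos_of_mem h.1),
      A1.length_nonneg (J.diam_pos_of_mem h.2.1) (J.diam_pos_of_mem u.2.2)]

theorem isNearest_iff_of_isBridge (h : A1.IsBridge I.carrier J.carrier z w) {x y : A1 k} :
    I.IsNearest J x y ↔ x = z ∧ y = w := by
  rw [IsNearest, dist_eq_of_isBridge h]
  constructor
  · rintro ⟨hx, hy, hxy⟩
    rw [h.2.2 x hx y hy] at hxy
    have h1 := A1.length_nonneg (I.diam_pos_of_mem hx) (I.diam_pos_of_mem h.1)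
    have h2 := A1.length_nonneg (J.diam_pos_of_mem h.2.1) (J.diam_pos_of_mem hy)
    exact ⟨A1.eq_of_length_eq_zero (I.diam_pos_of_mem hx) (I.diam_pos_of_mem h.1) (by linarith),
      (A1.eq_of_length_eq_zero (J.diam_pos_of_mem h.2.1) (J.diam_pos_of_mem hy)
        (by linarith)).symm⟩
  · rintro ⟨rfl, rfl⟩
    exact ⟨h.1, h.2.1, rfl⟩

theorem length_path_of_isBridge (h : A1.IsBridge I.carrier J.carrier z w) {s t : ℝ}
    (hs : s ∈ Set.Icc 0 I.length) (ht : t ∈ Set.Icc 0 J.length) :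
    (I.path s).length (J.path t) =
      |s - I.p.length z| + z.length w + |t - J.p.length w| := by
  rw [h.2.2 _ (I.path_mem hs) _ (J.path_mem ht),
    A1.length_eq_abs_sub I.hp.diam_pos I.hq.diam_pos (I.path_mem hs) h.1,
    A1.length_eq_abs_sub J.hp.diam_pos J.hq.diam_pos h.2.1 (J.path_mem ht),
    I.length_path hs, J.length_path ht, abs_sub_comm (J.p.length w)]

theorem kernelIntegral_self (I : Seg k) :
    Integrable logKernel (I.measure.prod I.measure) ∧
      kernelIntegral I.measure I.measure =
        I.length / 6 + ∫ s, Real.log (I.path s).diam ∂(arcMeasure I.length) := by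
  obtain ⟨h1, h2⟩ := I.logKernel_integral I (F := fun z => |z.1 - z.2|) (by fun_prop)
    fun s hs t ht => I.length_path_path hs ht
  refine ⟨h1, ?_⟩
  rw [h2, integral_abs_sub_arcMeasure_prod I.length_nonneg]
  ring

theorem kernelIntegral_of_isBridge (h : A1.IsBridge I.carrier J.carrier z w) :
    Integrable logKernel (I.measure.prod J.measure) ∧
      kernelIntegral I.measure J.measure =
        1 / 2 * (I.length / 2 - I.p.length z * z.length I.q / I.length + z.length w +
          (J.length / 2 - J.p.length w * w.length J.q / J.length) +
          (∫ s, Real.log (I.path s).diam ∂(arcMeasure I.length)) +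
          ∫ t, Real.log (J.path t).diam ∂(arcMeasure J.length)) := by
  obtain ⟨h1, h2⟩ := I.logKernel_integral J
    (F := fun u => |u.1 - I.p.length z| + z.length w + |u.2 - J.p.length w|) (by fun_prop)
    fun s hs t ht => length_path_of_isBridge h hs ht
  refine ⟨h1, ?_⟩
  have := isProbabilityMeasure_arcMeasure I.length_nonneg
  have := isProbabilityMeasure_arcMeasure J.length_nonneg
  have hint {f : Set.Icc 0 I.length × Set.Icc 0 J.length → ℝ} (hf : Continuous f) :
      Integrable f ((arcMeasure I.length).prod (arcMeasure J.length)) :=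
    hf.integrable_of_hasCompactSupport (HasCompactSupport.of_compactSpace _)
  have hI : I.length - I.p.length z = z.length I.q := by
    rw [Seg.length, ← A1.length_add_length h.1]
    ring
  have hJ : J.length - J.p.length w = w.length J.q := by
    rw [Seg.length, ← A1.length_add_length h.2.1]
    ring
  rw [h2, integral_add (hint (by fun_prop)) (hint (by fun_prop)),
    integral_add (hint (by fun_prop)) (hint (by fun_prop)),
    integral_fun_fst (fun s : Set.Icc 0 I.length => |(s : ℝ) - I.p.length z|),
    integral_fun_snd (fun t : Set.Icc 0 J.length => |(t : ℝ) - J.p.length w|),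
    integral_abs_sub_arcMeasure (I.length_mem_Icc h.1),
    integral_abs_sub_arcMeasure (J.length_mem_Icc h.2.1), hI, hJ]
  simp

/-- The integrals of `log diam` cancel between the mixed and the diagonal terms. The coefficient `1
/ 6` is `1 / 4 - 1 / 12`, from the mean distances to a point and between two points. -/
theorem energy_of_isBridge (h : A1.IsBridge I.carrier J.carrier z w) :
    EnergyDefined (I.diffMeasure J) (I.diffMeasure J) ∧
      I.E J = 1 / 6 * I.length + 1 / 6 * J.length + 1 / 2 * z.length w
        - 1 / 2 * (I.p.length z * z.length I.q / I.length)
        - 1 / 2 * (J.p.length w * w.length J.q / J.length) := by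
  obtain ⟨hII, eII⟩ := I.kernelIntegral_self
  obtain ⟨hJJ, eJJ⟩ := J.kernelIntegral_self
  obtain ⟨hIJ, eIJ⟩ := kernelIntegral_of_isBridge h
  obtain ⟨hJI, eJI⟩ := kernelIntegral_of_isBridge h.symm
  obtain ⟨hdef, hE⟩ := energy_toSignedMeasure_sub I.measure J.measure hII hIJ hJI hJJ
  refine ⟨hdef, ?_⟩
  rw [Seg.E, diffMeasure, hE, eII, eJJ, eIJ, eJI, A1.length_comm w z]
  ring

/-- By the inequality of arithmetic and geometric means; it yields `1 / 24 = 1 / 6 - 1 / 8` in the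
lower bound. -/
theorem length_mul_length_div_le (I : Seg k) (hz : z ∈ I.carrier) :
    I.p.length z * z.length I.q / I.length ≤ I.length / 4 := by
  have hadd : I.p.length z + z.length I.q = I.length := A1.length_add_length hz
  rcases I.length_nonneg.eq_or_lt with h | h
  · rw [← h]
    simp
  · rw [div_le_iff₀ h, ← hadd]
    nlinarith [sq_nonneg (I.p.length z - z.length I.q)]

end Seg

end Berkovich

end

theorem mainTheorem7 {k : Type*} [NormedField k] [IsUltrametricDist k] [CompleteSpace k]
    (Ia Ib : Berkovich.Seg k) (hI : (Ia.carrier ∩ Ib.carrier).Subsingleton) :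
    Berkovich.EnergyDefined (Ia.diffMeasure Ib) (Ia.diffMeasure Ib) ∧
    (∃! z : Berkovich.A1 k × Berkovich.A1 k, Ia.IsNearest Ib z.1 z.2) ∧
    (∀ za zb : Berkovich.A1 k, Ia.IsNearest Ib za zb →
      Ia.E Ib = 1 / 6 * Ia.length + 1 / 6 * Ib.length + 1 / 2 * Ia.dist Ib
        - 1 / 2 * (Ia.p.length za * za.length Ia.q / Ia.length)
        - 1 / 2 * (Ib.p.length zb * zb.length Ib.q / Ib.length)) ∧
    Ia.E Ib ≥ 1 / 24 * Ia.length + 1 / 24 * Ib.length + 1 / 2 * Ia.dist Ib := by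
  obtain ⟨z, w, h⟩ := Berkovich.A1.exists_isBridge hI
  obtain ⟨hdef, hE⟩ := Berkovich.Seg.energy_of_isBridge h
  have hdist := Berkovich.Seg.dist_eq_of_isBridge h
  refine ⟨hdef, ⟨(z, w), (Berkovich.Seg.isNearest_iff_of_isBridge h).2 ⟨rfl, rfl⟩, ?_⟩, ?_, ?_⟩
  · rintro ⟨x, y⟩ hxy
    obtain ⟨rfl, rfl⟩ := (Berkovich.Seg.isNearest_iff_of_isBridge h).1 hxy
    rfl
  · intro x y hxy
    obtain ⟨rfl, rfl⟩ := (Berkovich.Seg.isNearest_iff_of_isBridge h).1 hxy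
    rw [hE, hdist]
  · rw [hE, hdist]
    linarith [Ia.length_mul_length_div_le h.1, Ib.length_mul_length_div_le h.2.1]
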